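/- Let $\Bbbk$ be a field of characteristic $0$ and let $(V,c)$ be a two-dimensional braided vector space of diagonal type: $V$ has a basis $x_1,x_2$ with $c(x_i\otimes x_j)=q_{ij}\,x_j\otimes x_i$, where $q_{ij}\in\Bbbk^\times$. Put $q=q_{11}$, $r=q_{12}q_{21}$, $s=q_{22}$. Let $\mathfrak B(V)$ be the Nichols algebra of $V$, that is, the quotient of the tensor algebra $T(V)$ by the kernel of the quantum symmetrizers; it is graded by $\mathbb N_0^2$ with $\deg x_i=\alpha_i$, where $\alpha_1,\alpha_2$ is the standard basis of $\mathbb Z^2$. Let $\chi$ be the bicharacter on $\mathbb Z^2$ with $\chi(\alpha_i,\alpha_j)=q_{ij}$. Order the words in $x_1<x_2$ lexicographically (a proper prefix being smaller). A non-empty word $u$ is a Lyndon word if $u<vw$ for every decomposition $u=wv$ into non-empty words. For a Lyndon word $u$ the super-letter $[u]\in\mathfrak B(V)$ is defined by $[x_i]=x_i$ and $[u]=[v][w]-\chi(\deg v,\deg w)[w][v]$, where, for $u$ of length at least two, $u=vw$ is the decomposition into two Lyndon words with $v$ of minimal length; moreover $[u^k]=[u]^k$. A *root vector candidate* is an element $[w]$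 with $w=v^k$, where $v$ is a Lyndon word and $k=1$ or $k$ is the (finite) multiplicative order of $\chi(\deg v,\deg v)$. It is a *root vector* if it is not a linear combination of elements $[v_l]^{m_l}\cdots[v_1]^{m_1}$ with $l\ge 0$, $m_i\geq 1$, and root vector candidates $[v_1],\dots,[v_l]$ such that $w<v_1<\cdots<v_l$. The *multiplicity* of $\alpha\in\mathbb N_0^2$ is the number of words $w$ of degree $\alpha$ such that $[w]$ is a root vector (it is $0$ if $\alpha$ is not a root), and the number of root vector candidates of degree $\alpha$ is counted in the same way, by words. For $m\in\mathbb N_0$ let $(m)_q=\sum_{i=0}^{m-1}q^i$, $(m)_q^!=\prod_{i=1}^m(i)_q$ and $b_m=\prod_{j=0}^{m-1}(1-q^jr)$. Let $\mathbb J\subseteq\mathbb N_0$ be the set defined recursively by: $j\in\mathbb J$ if and only if $q^{j(j-1)/2}(-r)^js=-1$ and $q^{j+n-1}r^2\neq1$ for all $n\in\mathbb J$ with $n<j$. **Corollary.** Let $m\in\mathbb N_0$ be such that $(m)_q^!\,b_m\neq0$, and let $$m'=\begin{cases}(m+1)/2&\text{if $m$ is odd,}\\ m/2&\text{if $m$ is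 even and } q^{m^2/4}r^{m/2}s\neq-1,\\ m/2+1&\text{if $m$ is even and } q^{m^2/4}r^{m/2}s=-1.\end{cases}$$ Then the number of root vector candidates of degree $m\alpha_1+2\alpha_2$ is $m'$, and the multiplicity of $m\alpha_1+2\alpha_2$ is $$m'-\bigl|\mathbb J\cap[0,m]\bigr|.$$ -/

import Mathlib

/-!  Nichols algebras of diagonal type: words, super-letters, root vectors, multiplicities.

A braided vector space `(V, c)` of diagonal type with basis `x_0, …, x_{n-1}` and
`c (x_i ⊗ x_j) = q_{ij} x_j ⊗ x_i` is given by its braiding matrix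
`Q : Fin n → Fin n → 𝕜ˣ`, `Q i j = q_{ij}`.  The tensor algebra `T(V)` is the free algebra on
the basis, and a word in the basis is a `List (Fin n)`.  The order `<` on lists is the
lexicographic order, in which a proper prefix is smaller. -/

namespace DiagNichols

noncomputable section

variable {𝕜 : Type*} [Field 𝕜] {n : ℕ}

/-! ### The Nichols algebra -/

/-- The quantum symmetrizer `∑_{σ ∈ S_l} T_σ` on a word of length `l`.  The braid lift `T_σ` moves
the letter in position `a` to position `σ a`; two letters in positions `a < b` cross exactly when
`σ b < σ a`, and then contribute the factor `q_{ij}`, where `i, j` are the letters in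
positions `a, b`. -/
def qSymWord (Q : Fin n → Fin n → 𝕜ˣ) (w : List (Fin n)) : FreeAlgebra 𝕜 (Fin n) :=
  ∑ σ : Equiv.Perm (Fin w.length),
    (∏ p : Fin w.length × Fin w.length,
      if p.1 < p.2 ∧ σ p.2 < σ p.1 then (Q (w.get p.1) (w.get p.2) : 𝕜) else 1) •
    (List.ofFn fun p : Fin w.length => FreeAlgebra.ι 𝕜 (w.get (σ⁻¹ p))).prod

/-- The quantum symmetrizer on `T(V)`, the direct sum of the quantum symmetrizers of all
tensor powers of `V`. -/
def qSym (Q : Fin n → Fin n → 𝕜ˣ) :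
    FreeAlgebra 𝕜 (Fin n) →ₗ[𝕜] FreeAlgebra 𝕜 (Fin n) :=
  (FreeAlgebra.basisFreeMonoid 𝕜 (Fin n)).constr 𝕜 fun w => qSymWord Q (FreeMonoid.toList w)

/-- The Nichols algebra `𝔅(V)`: the quotient of `T(V)` by the (ideal generated by the) kernel of the quantum
symmetrizer; this kernel is an ideal. -/
abbrev NicholsAlgebra (Q : Fin n → Fin n → 𝕜ˣ) : Type _ :=
  RingQuot fun x y : FreeAlgebra 𝕜 (Fin n) => qSym Q x = qSym Q y

/-- The image of the basis vector `x_i` in the Nichols algebra. -/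
def gen (Q : Fin n → Fin n → 𝕜ˣ) (i : Fin n) : NicholsAlgebra Q :=
  RingQuot.mkAlgHom 𝕜 (fun x y : FreeAlgebra 𝕜 (Fin n) => qSym Q x = qSym Q y)
    (FreeAlgebra.ι 𝕜 i)

/-! ### Degrees and the bicharacter -/

/-- The degree of a word in `ℕ₀ⁿ`. -/
def degree (w : List (Fin n)) : Fin n → ℕ := fun i => w.count i

/-- The bicharacter with `χ(α_i, α_j) = q_{ij}`, on `ℕ₀ⁿ`. -/
def chi (Q : Fin n → Fin n → 𝕜ˣ) (α β : Fin n → ℕ) : 𝕜ˣ :=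
  ∏ i, ∏ j, Q i j ^ (α i * β j)

/-! ### Lyndon words and super-letters -/

/-- Lyndon words. -/
def IsLyndon (u : List (Fin n)) : Prop :=
  u ≠ [] ∧ ∀ w v : List (Fin n), w ≠ [] → v ≠ [] → u = w ++ v → u < v ++ w

/-- The length of the first factor `w` of the Shirshov decomposition `u = w v` of a Lyndon word
of length at least two: the least possible length in a decomposition into two Lyndon words. -/
def shirshovIndex (u : List (Fin n)) : ℕ :=
  sInf {i : ℕ | 0 < i ∧ i < u.length ∧ IsLyndon (u.take i) ∧ IsLyndon (u.drop i)}

/-- The super-letter `[u]` of a Lyndon word `u`: `[x_i] = x_i`, and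
`[u] = [v][w] - χ(deg v, deg w) [w][v]` for the Shirshov decomposition `u = v w`.
(Words of length one have no such decomposition, their `shirshovIndex` is `0`; the value at
words that are not Lyndon words is irrelevant.) -/
def superLetter (Q : Fin n → Fin n → 𝕜ˣ) (u : List (Fin n)) : NicholsAlgebra Q :=
  if _h : 0 < shirshovIndex u ∧ shirshovIndex u < u.length then
    superLetter Q (u.take (shirshovIndex u)) * superLetter Q (u.drop (shirshovIndex u)) -
      (chi Q (degree (u.take (shirshovIndex u))) (degree (u.drop (shirshovIndex u))) : 𝕜) •
        (superLetter Q (u.drop (shirshovIndex u)) * superLetter Q (u.take (shirshovIndex u)))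
  else
    match u with
    | [i] => gen Q i
    | _ => 0
termination_by u.length
decreasing_by
  all_goals
    simp only [List.length_take, List.length_drop]
    omega

/-! ### Root vectors and multiplicities -/

/-- `k ∈ O_α ∖ {∞}`: either `k = 1`, or the order `o` of `χ(α,α)` is finite and `k = o`
(in characteristic zero) respectively `k = o p^e` with `e ≥ 0` (in characteristic `p > 0`).
The exponential characteristic is `1` if the characteristic is zero, and `orderOf` is `0` for
elements of infinite order. -/
def IsAdmissibleExponent (Q : Fin n → Fin n → 𝕜ˣ) (α : Fin n → ℕ) (k : ℕ) : Prop :=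
  k = 1 ∨ (0 < orderOf (chi Q α α) ∧
    ∃ e : ℕ, k = orderOf (chi Q α α) * ringExpChar 𝕜 ^ e)

/-- A root vector candidate `[v ^ k]`, with `v` a Lyndon word and `k ∈ O_{deg v} ∖ {∞}`. -/
structure Candidate (Q : Fin n → Fin n → 𝕜ˣ) where
  /-- the Lyndon word `v` -/
  base : List (Fin n)
  /-- the exponent `k` -/
  exponent : ℕ
  lyndon : IsLyndon base
  admissible : IsAdmissibleExponent Q (degree base) exponent

namespace Candidate

variable {Q : Fin n → Fin n → 𝕜ˣ}

/-- The word `v ^ k`. -/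
def word (c : Candidate Q) : List (Fin n) := (List.replicate c.exponent c.base).flatten

/-- The element `[v ^ k] = [v] ^ k` of the Nichols algebra. -/
def vec (c : Candidate Q) : NicholsAlgebra Q := superLetter Q c.base ^ c.exponent

/-- The set of all `[v_k]^{m_k} ⋯ [v_1]^{m_1}` with `k ≥ 0`, root vector candidates
`[v_1], …, [v_k]` such that `w < v_1 < ⋯ < v_k`, and positive exponents `m_i`. -/
def largerMonomials (Q : Fin n → Fin n → 𝕜ˣ) (w : List (Fin n)) : Set (NicholsAlgebra Q) :=
  {a | ∃ l : List (Candidate Q × ℕ),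
    l.Pairwise (fun c d => d.1.word < c.1.word) ∧
    (∀ c ∈ l, w < c.1.word ∧ 0 < c.2) ∧
    a = (l.map fun c => c.1.vec ^ c.2).prod}

/-- A root vector candidate `[w]` is a root vector if it is not a linear combination of products
of larger root vector candidates. -/
def IsRootVector (c : Candidate Q) : Prop :=
  c.vec ∉ Submodule.span 𝕜 (largerMonomials Q c.word)

end Candidate

/-- The words `w` of degree `α` such that `[w]` is a root vector candidate. -/
def candidateWords (Q : Fin n → Fin n → 𝕜ˣ) (α : Fin n → ℕ) : Set (List (Fin n)) :=
  {w | degree w = α ∧ ∃ c : Candidate Q, c.word = w}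

/-- The words `w` of degree `α` such that `[w]` is a root vector. -/
def rootWords (Q : Fin n → Fin n → 𝕜ˣ) (α : Fin n → ℕ) : Set (List (Fin n)) :=
  {w | degree w = α ∧ ∃ c : Candidate Q, c.word = w ∧ c.IsRootVector}

/-- The multiplicity of `α` as a root of the Nichols algebra
(`0` if and only if `α` is not a positive root). -/
def multiplicity (Q : Fin n → Fin n → 𝕜ˣ) (α : Fin n → ℕ) : ℕ := (rootWords Q α).ncard

/-! ### The data entering the formula -/

/-- The quantum integer `(m)_q`. -/
def qInt (q : 𝕜) (m : ℕ) : 𝕜 := ∑ i ∈ Finset.range m, q ^ i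

/-- The quantum factorial `(m)_q^!`. -/
def qFactorial (q : 𝕜) (m : ℕ) : 𝕜 := ∏ i ∈ Finset.Icc 1 m, qInt q i

/-- `b_m = ∏_{j < m} (1 - q^j r)`. -/
def bCoeff (q r : 𝕜) (m : ℕ) : 𝕜 := ∏ j ∈ Finset.range m, (1 - q ^ j * r)

/-- The condition `j ∈ 𝕁_{q,r,s}`, by recursion on `j`.
(The exponent `j + i - 1` only occurs for `i < j`, so it is not truncated.) -/
def MemJ (q r s : 𝕜) (j : ℕ) : Prop :=
  q ^ (j * (j - 1) / 2) * (-r) ^ j * s = -1 ∧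
    ∀ i : ℕ, i < j → MemJ q r s i → q ^ (j + i - 1) * r ^ 2 ≠ 1
termination_by j

/-- The set `𝕁_{q,r,s}`. -/
def setJ (q r s : 𝕜) : Set ℕ := {j | MemJ q r s j}

open Classical in
/-- The number `m'`. -/
def mPrime (q r s : 𝕜) (m : ℕ) : ℕ :=
  if Odd m then (m + 1) / 2
  else if q ^ (m ^ 2 / 4) * r ^ (m / 2) * s = -1 then m / 2 + 1
  else m / 2

end

end DiagNichols

/-! Write u_k = (ad x_1)^k(x_2) and y_k = (k)_q (1 - q^{k-1} r). The hypothesis on m says that y_1,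
…, y_m are nonzero.

In degree m α_1 + 2 α_2 the candidates are the words 0^a 1 0^b 1 with a + b = m and b < a, together
with the square b = a when χ takes the value -1 on the degree of 0^a 1. Counting the indices a gives
m'. Everything happens in the space spanned by the u_i ⊗ u_j with i + j = m, mapped to the Nichols
algebra by multiplication. A candidate is the image of a tensor with leading coefficient 1 at (a,
b), and the monomials in larger candidates span exactly the products u_i u_j with i, j < a
(`largerMonomials_subset`, `adGen_mul_adGen_mem_span`). So a candidate fails to be a root vector
exactly when a is the leading index of a relation among the products
(`mem_span_largerMonomials_iff`), and the number of leading indices is the dimension of the space of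
relations (`finrank_eq_card_isLeading`).

An element of the Nichols algebra vanishes if its augmentation and its skew derivatives vanish. The
derivation ∂_1 kills all u_i u_j, and ∂_2 after multiplication is an injective map composed with id
+ c, where c is the braiding. Hence the relations are the kernel of id + c (`mulTens_eq_zero_iff`).

Its dimension comes from a q-analogue of sl_2 theory. A raising operator X (braided commutator with
x_1) and a lowering operator Y commute with c, and YX - qXY is the scalar 1 - q^{2m} r^2 in degree
m. The kernel of Y in degree n is a line spanned by v_n, on which c acts by ε_n = q^{n(n-1)/2}
(-r)^n s. Generically the vectors X^{m-n} v_n form a basis, and the -1 eigenspace is counted by the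
n ≤ m with ε_n = -1. In the resonant case q^{2n+k} r^2 = 1 the vector X^{k+1} v_n is itself a
multiple of v_{n+k+1}, and a direction is missing. Deforming q_{12} to first order supplies it and
shows that it lies in a Jordan block of c when ε_n = -1 (`exists_jordan`). It therefore adds no
eigenvector in characteristic zero, which is why 𝕁 excludes the resonant indices
(`finrank_relTens`). -/

namespace DiagNichols

noncomputable section

/-! ### Skew derivations of the free algebra -/

section FreeSkew

variable {𝕜 : Type*} [Field 𝕜] {n : ℕ}

/-- The algebra endomorphism of the free algebra scaling the `j`-th generator by `t j`. -/
def freeScale (t : Fin n → 𝕜) : FreeAlgebra 𝕜 (Fin n) →ₐ[𝕜] FreeAlgebra 𝕜 (Fin n) :=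
  FreeAlgebra.lift 𝕜 fun j => t j • FreeAlgebra.ι 𝕜 j

/-- The upper triangular representation whose off-diagonal entry is the skew derivation. -/
def freeDerivHom (t : Fin n → 𝕜) (i : Fin n) :
    FreeAlgebra 𝕜 (Fin n) →ₐ[𝕜] Matrix (Fin 2) (Fin 2) (FreeAlgebra 𝕜 (Fin n)) :=
  FreeAlgebra.lift 𝕜 fun j =>
    !![FreeAlgebra.ι 𝕜 j, if i = j then 1 else 0; 0, t j • FreeAlgebra.ι 𝕜 j]

/-- The skew derivation `d` with `d (x y) = x d(y) + d(x) σ(y)`, where `σ` is `freeScale t`, and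
`d x_j = δ_{ij}`. -/
def freeDeriv (t : Fin n → 𝕜) (i : Fin n) :
    FreeAlgebra 𝕜 (Fin n) →ₗ[𝕜] FreeAlgebra 𝕜 (Fin n) where
  toFun x := freeDerivHom t i x 0 1
  map_add' x y := by simp
  map_smul' c x := by simp

@[simp] lemma freeScale_ι (t : Fin n → 𝕜) (j : Fin n) :
    freeScale t (FreeAlgebra.ι 𝕜 j) = t j • FreeAlgebra.ι 𝕜 j := by
  simp [freeScale]

lemma freeDerivHom_eq (t : Fin n → 𝕜) (i : Fin n) (x : FreeAlgebra 𝕜 (Fin n)) :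
    freeDerivHom t i x = !![x, freeDeriv t i x; 0, freeScale t x] := by
  suffices h : freeDerivHom t i x 0 0 = x ∧ freeDerivHom t i x 1 0 = 0 ∧
      freeDerivHom t i x 1 1 = freeScale t x by
    ext a b
    fin_cases a <;> fin_cases b <;> simp [h, freeDeriv]
  induction x using FreeAlgebra.induction with
  | grade0 r => simp [Matrix.algebraMap_matrix_apply]
  | grade1 j => simp [freeDerivHom]
  | mul a b ha hb => simp [Matrix.mul_apply, Fin.sum_univ_two, ha, hb]
  | add a b ha hb => simp [ha, hb]

/-- This is the upper right entry of a product of triangular matrices. Encoding the derivation as a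
matrix-valued algebra map lets the universal properties of free algebra and quotient define it. -/
lemma freeDeriv_mul (t : Fin n → 𝕜) (i : Fin n) (x y : FreeAlgebra 𝕜 (Fin n)) :
    freeDeriv t i (x * y) = x * freeDeriv t i y + freeDeriv t i x * freeScale t y := by
  have h := congrFun (congrFun (map_mul (freeDerivHom t i) x y) 0) 1
  rw [freeDerivHom_eq t i x, freeDerivHom_eq t i y, freeDerivHom_eq t i (x * y)] at h
  simpa [Matrix.mul_apply, Fin.sum_univ_two] using h

@[simp] lemma freeDeriv_algebraMap (t : Fin n → 𝕜) (i : Fin n) (r : 𝕜) :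
    freeDeriv t i (algebraMap 𝕜 _ r) = 0 := by
  simp [freeDeriv, Matrix.algebraMap_matrix_apply]

@[simp] lemma freeDeriv_one (t : Fin n → 𝕜) (i : Fin n) :
    freeDeriv t i 1 = 0 := by
  simp [freeDeriv]

@[simp] lemma freeDeriv_ι (t : Fin n → 𝕜) (i j : Fin n) :
    freeDeriv t i (FreeAlgebra.ι 𝕜 j) = if i = j then 1 else 0 := by
  simp [freeDeriv, freeDerivHom]

/-- The product of the generators with indices `f 0, …, f (l - 1)`. -/
def freeWord {l : ℕ} (f : Fin l → Fin n) : FreeAlgebra 𝕜 (Fin n) :=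
  (List.ofFn fun p => FreeAlgebra.ι 𝕜 (f p)).prod

lemma freeWord_succ {l : ℕ} (f : Fin (l + 1) → Fin n) :
    (freeWord f : FreeAlgebra 𝕜 (Fin n)) =
      FreeAlgebra.ι 𝕜 (f 0) * freeWord fun p => f p.succ := by
  simp [freeWord, List.ofFn_succ]

lemma freeWord_succ' {l : ℕ} (f : Fin (l + 1) → Fin n) :
    (freeWord f : FreeAlgebra 𝕜 (Fin n)) =
      (freeWord fun p => f p.castSucc) * FreeAlgebra.ι 𝕜 (f (Fin.last l)) := by
  rw [freeWord, List.ofFn_succ', List.concat_eq_append, List.prod_append]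
  simp [freeWord]

lemma freeScale_freeWord (t : Fin n → 𝕜) {l : ℕ} (f : Fin l → Fin n) :
    freeScale t (freeWord f) = (∏ b, t (f b)) • freeWord f := by
  induction l with
  | zero => simp [freeWord]
  | succ l ih =>
    rw [freeWord_succ, map_mul, ih, freeScale_ι, Fin.prod_univ_succ, smul_mul_smul_comm]

/-- The twist acts on right factors, so deleting a letter costs the weights of the letters to its
right. These are the crossing factors in `qSymFun_succ`. -/
lemma freeDeriv_freeWord (t : Fin n → 𝕜) (i : Fin n) {l : ℕ} (f : Fin (l + 1) → Fin n) :
    freeDeriv t i (freeWord f) = ∑ p, if i = f p then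
      (∏ b, if p < p.succAbove b then t (f (p.succAbove b)) else 1) •
        freeWord (fun b => f (p.succAbove b)) else 0 := by
  induction l with
  | zero => rw [Fin.sum_univ_one]; simp [freeWord]
  | succ l ih =>
    rw [freeWord_succ, freeDeriv_mul, ih, Fin.sum_univ_succ (n := l + 1), add_comm, freeDeriv_ι,
      freeScale_freeWord]
    congr 1
    · simp
    · rw [Finset.mul_sum]
      refine Finset.sum_congr rfl fun p _ => ?_
      split_ifs with h
      · rw [Fin.prod_univ_succ, freeWord_succ (fun b => f (p.succ.succAbove b))]
        simp [Fin.succ_succAbove_succ]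
      · simp

end FreeSkew

/-! ### The quantum symmetrizer and skew derivations -/

section Symmetrizer

variable {𝕜 : Type*} [Field 𝕜] {n : ℕ}

/-- The permutation sending `p` to the last position and permuting the others by `τ`. -/
def lastPerm {l : ℕ} (x : Fin (l + 1) × Equiv.Perm (Fin l)) : Equiv.Perm (Fin (l + 1)) :=
  (finSuccEquiv' x.1).trans ((Equiv.optionCongr x.2).trans (finSuccEquiv' (Fin.last l)).symm)

@[simp] lemma lastPerm_self {l : ℕ} (p : Fin (l + 1)) (τ : Equiv.Perm (Fin l)) :
    lastPerm (p, τ) p = Fin.last l := by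
  simp [lastPerm]

@[simp] lemma lastPerm_succAbove {l : ℕ} (p : Fin (l + 1)) (τ : Equiv.Perm (Fin l)) (a : Fin l) :
    lastPerm (p, τ) (p.succAbove a) = (τ a).castSucc := by
  simp [lastPerm]

@[simp] lemma lastPerm_inv_last {l : ℕ} (p : Fin (l + 1)) (τ : Equiv.Perm (Fin l)) :
    (lastPerm (p, τ))⁻¹ (Fin.last l) = p := by
  rw [Equiv.Perm.inv_eq_iff_eq]; simp

@[simp] lemma lastPerm_inv_castSucc {l : ℕ} (p : Fin (l + 1)) (τ : Equiv.Perm (Fin l))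
    (a : Fin l) : (lastPerm (p, τ))⁻¹ a.castSucc = p.succAbove (τ⁻¹ a) := by
  rw [Equiv.Perm.inv_eq_iff_eq]; simp

lemma lastPerm_bijective (l : ℕ) : Function.Bijective (lastPerm (l := l)) := by
  rw [Fintype.bijective_iff_injective_and_card]
  constructor
  · rintro ⟨p, τ⟩ ⟨p', τ'⟩ h
    have hp : p = p' := by
      rw [← lastPerm_inv_last p τ, h, lastPerm_inv_last]
    subst hp
    congr 1
    refine Equiv.ext fun a => ?_
    have := congrArg (fun σ : Equiv.Perm _ => σ (p.succAbove a)) h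
    simpa using this
  · simp [Fintype.card_perm, Nat.factorial_succ]

/-- The quantum symmetrizer on the word with letters `f 0, …, f (l - 1)`. -/
def qSymFun (Q : Fin n → Fin n → 𝕜ˣ) {l : ℕ} (f : Fin l → Fin n) : FreeAlgebra 𝕜 (Fin n) :=
  ∑ σ : Equiv.Perm (Fin l),
    (∏ p : Fin l × Fin l,
      if p.1 < p.2 ∧ σ p.2 < σ p.1 then (Q (f p.1) (f p.2) : 𝕜) else 1) •
    freeWord fun p => f (σ⁻¹ p)

/-- Permutations are sorted by the position p that is sent to the end: its letter crosses exactly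
the letters to its right, and the remaining letters are permuted freely. -/
lemma qSymFun_succ (Q : Fin n → Fin n → 𝕜ˣ) {l : ℕ} (f : Fin (l + 1) → Fin n) :
    qSymFun Q f = ∑ p : Fin (l + 1),
      (∏ b, if p < p.succAbove b then (Q (f p) (f (p.succAbove b)) : 𝕜) else 1) •
        (qSymFun Q (fun b => f (p.succAbove b)) * FreeAlgebra.ι 𝕜 (f p)) := by
  rw [qSymFun, ← (lastPerm_bijective l).sum_comp, Fintype.sum_prod_type]
  refine Finset.sum_congr rfl fun p _ => ?_
  rw [qSymFun, Finset.sum_mul, Finset.smul_sum]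
  refine Finset.sum_congr rfl fun τ _ => ?_
  rw [freeWord_succ', smul_mul_assoc, smul_smul]
  congr 1
  · rw [Fintype.prod_prod_type, Fin.prod_univ_succAbove _ p, Fin.prod_univ_succAbove _ p,
      Fintype.prod_prod_type]
    congr 1
    · simp [Fin.castSucc_lt_last]
    · refine Finset.prod_congr rfl fun a _ => ?_
      rw [Fin.prod_univ_succAbove _ p]
      simp [Fin.succAbove_lt_succAbove_iff, Fin.not_lt.mpr (Fin.le_last _)]
  · simp

lemma qSymFun_cast (Q : Fin n → Fin n → 𝕜ˣ) {l l' : ℕ} (h : l = l') (g : Fin l' → Fin n) :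
    qSymFun Q (g ∘ Fin.cast h) = qSymFun Q g := by
  subst h; rfl

lemma basisFreeMonoid_apply (w : List (Fin n)) :
    FreeAlgebra.basisFreeMonoid 𝕜 (Fin n) (FreeMonoid.ofList w) =
      (w.map (FreeAlgebra.ι 𝕜)).prod := by
  have : FreeAlgebra.basisFreeMonoid 𝕜 (Fin n) (FreeMonoid.ofList w) =
      FreeAlgebra.equivMonoidAlgebraFreeMonoid.symm
        (MonoidAlgebra.of 𝕜 (FreeMonoid (Fin n)) (FreeMonoid.ofList w)) := rfl
  rw [this]
  simp [FreeAlgebra.equivMonoidAlgebraFreeMonoid, FreeMonoid.lift_apply]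

lemma qSym_freeWord (Q : Fin n → Fin n → 𝕜ˣ) {l : ℕ} (f : Fin l → Fin n) :
    qSym Q (freeWord f) = qSymFun Q f := by
  have h : (freeWord f : FreeAlgebra 𝕜 (Fin n)) =
      FreeAlgebra.basisFreeMonoid 𝕜 (Fin n) (FreeMonoid.ofList (List.ofFn f)) := by
    rw [basisFreeMonoid_apply, List.map_ofFn]; rfl
  rw [h, qSym, Module.Basis.constr_basis]
  have h2 : (List.ofFn f).get = f ∘ Fin.cast (List.length_ofFn) := by
    ext p; simp; rfl
  calc qSymFun Q (List.ofFn f).get = _ := by rw [h2, qSymFun_cast]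

lemma freeAlgebra_hom_ext {M : Type*} [AddCommMonoid M] [Module 𝕜 M]
    {φ ψ : FreeAlgebra 𝕜 (Fin n) →ₗ[𝕜] M}
    (h : ∀ (l : ℕ) (f : Fin l → Fin n), φ (freeWord f) = ψ (freeWord f)) : φ = ψ := by
  refine (FreeAlgebra.basisFreeMonoid 𝕜 (Fin n)).ext fun w => ?_
  have := h _ (FreeMonoid.toList w).get
  have e : (freeWord (FreeMonoid.toList w).get : FreeAlgebra 𝕜 (Fin n)) =
      FreeAlgebra.basisFreeMonoid 𝕜 (Fin n) w := by
    rw [← FreeMonoid.ofList_toList w, basisFreeMonoid_apply, freeWord]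
    congr 1
    apply List.ext_getElem <;> simp
  rwa [e] at this

lemma qSym_expand (Q : Fin n → Fin n → 𝕜ˣ) (x : FreeAlgebra 𝕜 (Fin n)) :
    qSym Q x = algebraMap 𝕜 _ (FreeAlgebra.algebraMapInv x) +
      ∑ i, qSym Q (freeDeriv (fun j => (Q i j : 𝕜)) i x) * FreeAlgebra.ι 𝕜 i := by
  have key : qSym Q = (Algebra.linearMap 𝕜 _).comp
      (FreeAlgebra.algebraMapInv (R := 𝕜) (X := Fin n)).toLinearMap +
      ∑ i, (LinearMap.mulRight 𝕜 (FreeAlgebra.ι 𝕜 i)).comp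
        ((qSym Q).comp (freeDeriv (fun j => (Q i j : 𝕜)) i)) := by
    refine freeAlgebra_hom_ext fun l f => ?_
    cases l with
    | zero =>
      have : (freeWord f : FreeAlgebra 𝕜 (Fin n)) = 1 := by simp [freeWord]
      have h1 : qSymFun Q f = 1 := by simp [qSymFun, freeWord]
      rw [qSym_freeWord, h1]
      simp [this]
    | succ l =>
      rw [qSym_freeWord, qSymFun_succ]
      simp only [LinearMap.add_apply, LinearMap.coe_comp, Function.comp_apply,
        LinearMap.sum_apply, freeDeriv_freeWord, map_sum, LinearMap.mulRight_apply]
      rw [Finset.sum_comm]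
      have h0 : FreeAlgebra.algebraMapInv (freeWord f : FreeAlgebra 𝕜 (Fin n)) = 0 := by
        rw [freeWord_succ, map_mul]
        simp [FreeAlgebra.algebraMapInv]
      simp only [AlgHom.toLinearMap_apply, h0, map_zero, zero_add]
      refine Finset.sum_congr rfl fun p _ => ?_
      rw [Finset.sum_eq_single (f p)]
      · simp [qSym_freeWord]
      · intro b _ hb
        simp [hb]
      · simp
  conv_lhs => rw [key]
  simp

end Symmetrizer

/-! ### Skew derivations of the Nichols algebra -/

section NicholsSkew

variable {𝕜 : Type*} [Field 𝕜] {n : ℕ} (Q : Fin n → Fin n → 𝕜ˣ)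

@[simp] lemma algebraMapInv_qSym (x : FreeAlgebra 𝕜 (Fin n)) :
    FreeAlgebra.algebraMapInv (qSym Q x) = FreeAlgebra.algebraMapInv x := by
  conv_lhs => rw [qSym_expand]
  simp [FreeAlgebra.algebraMapInv]

/-- For zero weights the twist is the augmentation, so the derivation strips a final letter x_i.
Applied to `qSym_expand` it selects one summand. This makes the twisted derivations descend to the
Nichols algebra. -/
lemma freeDeriv_zero_qSym (i : Fin n) (x : FreeAlgebra 𝕜 (Fin n)) :
    freeDeriv 0 i (qSym Q x) = qSym Q (freeDeriv (fun j => (Q i j : 𝕜)) i x) := by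
  conv_lhs => rw [qSym_expand]
  simp [freeDeriv_mul]

lemma qSym_freeScale (t : Fin n → 𝕜) (x : FreeAlgebra 𝕜 (Fin n)) :
    qSym Q (freeScale t x) = freeScale t (qSym Q x) := by
  have : (qSym Q).comp (freeScale t).toLinearMap = (freeScale t).toLinearMap.comp (qSym Q) := by
    refine freeAlgebra_hom_ext fun l f => ?_
    simp only [LinearMap.comp_apply, AlgHom.toLinearMap_apply, freeScale_freeWord, map_smul,
      qSym_freeWord, qSymFun, map_sum, Finset.smul_sum]
    refine Finset.sum_congr rfl fun σ _ => ?_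
    rw [smul_comm, Equiv.prod_comp (σ⁻¹) fun b => t (f b)]
  exact DFunLike.congr_fun this x

/-- The projection of the free algebra onto the Nichols algebra. -/
def toNichols : FreeAlgebra 𝕜 (Fin n) →ₐ[𝕜] NicholsAlgebra Q :=
  RingQuot.mkAlgHom 𝕜 (fun x y : FreeAlgebra 𝕜 (Fin n) => qSym Q x = qSym Q y)

lemma toNichols_surjective : Function.Surjective (toNichols Q) :=
  RingQuot.mkAlgHom_surjective 𝕜 _

@[simp] lemma toNichols_ι (i : Fin n) : toNichols Q (FreeAlgebra.ι 𝕜 i) = gen Q i := rfl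

variable {Q}

lemma toNichols_eq_of_qSym_eq {x y : FreeAlgebra 𝕜 (Fin n)} (h : qSym Q x = qSym Q y) :
    toNichols Q x = toNichols Q y :=
  RingQuot.mkAlgHom_rel 𝕜 h

variable (Q)

/-- The augmentation of the Nichols algebra. -/
def counit : NicholsAlgebra Q →ₐ[𝕜] 𝕜 :=
  RingQuot.liftAlgHom 𝕜 ⟨FreeAlgebra.algebraMapInv, fun x y h => by
    rw [← algebraMapInv_qSym Q x, h, algebraMapInv_qSym]⟩

@[simp] lemma counit_toNichols (x : FreeAlgebra 𝕜 (Fin n)) :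
    counit Q (toNichols Q x) = FreeAlgebra.algebraMapInv x :=
  RingQuot.liftAlgHom_mkAlgHom_apply _ _ _ _

/-- The algebra endomorphism of the Nichols algebra scaling the `j`-th generator by `t j`. -/
def scale (t : Fin n → 𝕜) : NicholsAlgebra Q →ₐ[𝕜] NicholsAlgebra Q :=
  RingQuot.liftAlgHom 𝕜 ⟨(toNichols Q).comp (freeScale t), fun x y h =>
    toNichols_eq_of_qSym_eq
      ((qSym_freeScale Q t x).trans ((congrArg _ h).trans (qSym_freeScale Q t y).symm))⟩

lemma scale_toNichols (t : Fin n → 𝕜) (x : FreeAlgebra 𝕜 (Fin n)) :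
    scale Q t (toNichols Q x) = toNichols Q (freeScale t x) :=
  RingQuot.liftAlgHom_mkAlgHom_apply _ _ _ _

/-- The upper triangular representation of the Nichols algebra whose off-diagonal entry is the
skew derivation `skewDeriv Q i`. -/
def skewDerivHom (i : Fin n) :
    NicholsAlgebra Q →ₐ[𝕜] Matrix (Fin 2) (Fin 2) (NicholsAlgebra Q) :=
  RingQuot.liftAlgHom 𝕜
    ⟨(toNichols Q).mapMatrix.comp (freeDerivHom (fun j => (Q i j : 𝕜)) i), fun x y h => by
      -- Each matrix entry respects the defining relation, because the symmetrizer intertwines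
      -- derivations and rescalings. The lift then passes to the generated ideal, so it need not be
      -- known that the kernel is an ideal.
      have h1 := toNichols_eq_of_qSym_eq h
      have h2 : toNichols Q (freeDeriv (fun j => (Q i j : 𝕜)) i x) =
          toNichols Q (freeDeriv (fun j => (Q i j : 𝕜)) i y) :=
        toNichols_eq_of_qSym_eq (by rw [← freeDeriv_zero_qSym, h, freeDeriv_zero_qSym])
      have h3 : toNichols Q (freeScale (fun j => (Q i j : 𝕜)) x) =
          toNichols Q (freeScale (fun j => (Q i j : 𝕜)) y) :=
        toNichols_eq_of_qSym_eq (by rw [qSym_freeScale, h, qSym_freeScale])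
      ext a b
      fin_cases a <;> fin_cases b <;> simp [freeDerivHom_eq, h1, h2, h3]⟩

/-- The right skew derivation `∂_i` of the Nichols algebra. -/
def skewDeriv (i : Fin n) : NicholsAlgebra Q →ₗ[𝕜] NicholsAlgebra Q where
  toFun x := skewDerivHom Q i x 0 1
  map_add' x y := by simp
  map_smul' c x := by simp

lemma skewDeriv_toNichols (i : Fin n) (x : FreeAlgebra 𝕜 (Fin n)) :
    skewDeriv Q i (toNichols Q x) = toNichols Q (freeDeriv (fun j => (Q i j : 𝕜)) i x) := by
  have : skewDerivHom Q i (toNichols Q x) =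
      (toNichols Q).mapMatrix (freeDerivHom (fun j => (Q i j : 𝕜)) i x) :=
    RingQuot.liftAlgHom_mkAlgHom_apply _ _ _ _
  simp [skewDeriv, this, freeDerivHom_eq]

@[simp] lemma scale_gen (t : Fin n → 𝕜) (i : Fin n) : scale Q t (gen Q i) = t i • gen Q i := by
  rw [← toNichols_ι, scale_toNichols, freeScale_ι, map_smul]

@[simp] lemma counit_gen (i : Fin n) : counit Q (gen Q i) = 0 := by
  rw [← toNichols_ι, counit_toNichols]
  simp [FreeAlgebra.algebraMapInv]

@[simp] lemma skewDeriv_gen (i j : Fin n) :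
    skewDeriv Q i (gen Q j) = if i = j then 1 else 0 := by
  rw [← toNichols_ι, skewDeriv_toNichols, freeDeriv_ι]
  split_ifs <;> simp

@[simp] lemma skewDeriv_one (i : Fin n) : skewDeriv Q i 1 = 0 := by
  rw [← map_one (toNichols Q), skewDeriv_toNichols, freeDeriv_one, map_zero]

lemma skewDeriv_mul (i : Fin n) (x y : NicholsAlgebra Q) :
    skewDeriv Q i (x * y) =
      x * skewDeriv Q i y + skewDeriv Q i x * scale Q (fun j => (Q i j : 𝕜)) y := by
  obtain ⟨x, rfl⟩ := toNichols_surjective Q x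
  obtain ⟨y, rfl⟩ := toNichols_surjective Q y
  simp only [← map_mul, skewDeriv_toNichols, freeDeriv_mul, map_add, scale_toNichols]

/-- The linear functional `ε ∘ ∂_{i_k} ∘ ⋯ ∘ ∂_{i_1}` attached to the word `i_1 … i_k`. -/
def coefficient : List (Fin n) → NicholsAlgebra Q →ₗ[𝕜] 𝕜
  | [] => (counit Q).toLinearMap
  | i :: w => (coefficient w).comp (skewDeriv Q i)

/-- The analogue of `coefficient` for the untwisted derivations of the free algebra. -/
def freeCoefficient : List (Fin n) → FreeAlgebra 𝕜 (Fin n) →ₗ[𝕜] 𝕜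
  | [] => FreeAlgebra.algebraMapInv.toLinearMap
  | i :: w => (freeCoefficient w).comp (freeDeriv 0 i)

/-- The untwisted derivations remove letters from the right end, hence the reversal. -/
lemma freeCoefficient_word (v w : List (Fin n)) :
    freeCoefficient w ((v.reverse.map (FreeAlgebra.ι 𝕜)).prod) = if v = w then 1 else 0 := by
  induction w generalizing v with
  | nil =>
    cases v <;> simp [freeCoefficient, FreeAlgebra.algebraMapInv]
  | cons i w ih =>
    cases v with
    | nil => simp [freeCoefficient]
    | cons j v =>
      rw [freeCoefficient, LinearMap.comp_apply]
      simp only [List.reverse_cons, List.map_append, List.prod_append, List.map_cons,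
        List.map_nil, List.prod_singleton, freeDeriv_mul, freeDeriv_ι, freeScale_ι]
      by_cases h : i = j
      · have := ih v
        rw [List.map_reverse] at this
        simp [h, this]
      · simp [h, Ne.symm h]

lemma eq_zero_of_freeCoefficient {x : FreeAlgebra 𝕜 (Fin n)}
    (h : ∀ w, freeCoefficient w x = 0) : x = 0 := by
  have key : ∀ (w : List (Fin n)), (FreeAlgebra.basisFreeMonoid 𝕜 (Fin n)).coord
      (FreeMonoid.ofList w) = freeCoefficient w.reverse := by
    intro w
    refine (FreeAlgebra.basisFreeMonoid 𝕜 (Fin n)).ext fun v => ?_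
    have h2 := freeCoefficient_word (𝕜 := 𝕜) (FreeMonoid.toList v).reverse w.reverse
    rw [List.reverse_reverse, ← basisFreeMonoid_apply, FreeMonoid.ofList_toList] at h2
    rw [h2]
    simp only [Module.Basis.coord_apply, Module.Basis.repr_self, List.reverse_inj]
    classical
    rw [Finsupp.single_apply]
    exact if_congr Iff.rfl rfl rfl
  refine (FreeAlgebra.basisFreeMonoid 𝕜 (Fin n)).forall_coord_eq_zero_iff.mp fun w => ?_
  rw [← FreeMonoid.ofList_toList w, key]
  exact h _

lemma coefficient_toNichols (w : List (Fin n)) (x : FreeAlgebra 𝕜 (Fin n)) :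
    coefficient Q w (toNichols Q x) = freeCoefficient w (qSym Q x) := by
  induction w generalizing x with
  | nil => simp [coefficient, freeCoefficient]
  | cons i w ih => simp [coefficient, freeCoefficient, skewDeriv_toNichols, ih,
      freeDeriv_zero_qSym]

variable {Q}

/-- By `coefficient_toNichols` these functionals read off every coefficient of the symmetrization of
a representative; if all vanish, the representative is in the kernel of `qSym`. -/
lemma eq_zero_of_coefficient {x : NicholsAlgebra Q} (h : ∀ w, coefficient Q w x = 0) : x = 0 := by
  obtain ⟨x, rfl⟩ := toNichols_surjective Q x
  rw [← map_zero (toNichols Q)]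
  refine toNichols_eq_of_qSym_eq ?_
  rw [map_zero]
  exact eq_zero_of_freeCoefficient fun w => by rw [← coefficient_toNichols, h]

lemma eq_zero_of_skewDeriv {x : NicholsAlgebra Q} (h0 : counit Q x = 0)
    (h : ∀ i, skewDeriv Q i x = 0) : x = 0 := by
  refine eq_zero_of_coefficient fun w => ?_
  cases w with
  | nil => simpa [coefficient] using h0
  | cons i w => simp [coefficient, h]

end NicholsSkew

/-! ### The grading -/

section Grading

variable {𝕜 : Type*} [Field 𝕜] {n : ℕ} (Q : Fin n → Fin n → 𝕜ˣ)

/-- The homogeneous component of degree `α` of the Nichols algebra. -/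
def graded (α : Fin n → ℕ) : Submodule 𝕜 (NicholsAlgebra Q) :=
  Submodule.span 𝕜 {x | ∃ v : List (Fin n), degree v = α ∧ (v.map (gen Q)).prod = x}

lemma degree_append (v w : List (Fin n)) : degree (v ++ w) = degree v + degree w := by
  ext i; simp [degree]

variable {Q}

lemma mul_mem_graded {α β : Fin n → ℕ} {x y : NicholsAlgebra Q} (hx : x ∈ graded Q α)
    (hy : y ∈ graded Q β) : x * y ∈ graded Q (α + β) := by
  have := Submodule.mul_mem_mul hx hy
  rw [graded, graded, Submodule.span_mul_span] at this
  refine Submodule.span_mono ?_ this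
  rintro _ ⟨_, ⟨v, rfl, rfl⟩, _, ⟨w, rfl, rfl⟩, rfl⟩
  exact ⟨v ++ w, degree_append v w, by simp⟩

lemma one_mem_graded : (1 : NicholsAlgebra Q) ∈ graded Q 0 :=
  Submodule.subset_span ⟨[], by ext i; simp [degree], by simp⟩

lemma gen_mem_graded (i : Fin n) : gen Q i ∈ graded Q (degree [i]) :=
  Submodule.subset_span ⟨[i], rfl, by simp⟩

lemma pow_mem_graded {α : Fin n → ℕ} {x : NicholsAlgebra Q} (hx : x ∈ graded Q α) (k : ℕ) :
    x ^ k ∈ graded Q (k • α) := by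
  induction k with
  | zero => simpa using one_mem_graded
  | succ k ih => rw [pow_succ, succ_nsmul]; exact mul_mem_graded ih hx

lemma superLetter_mem_graded (u : List (Fin n)) : superLetter Q u ∈ graded Q (degree u) := by
  induction hu : u.length using Nat.strong_induction_on generalizing u with
  | _ N ih =>
    subst hu
    rw [superLetter]
    split_ifs with h
    · have h1 := ih (u.take (shirshovIndex u)).length (by simp; omega) _ rfl
      have h2 := ih (u.drop (shirshovIndex u)).length (by simp; omega) _ rfl
      have e : degree u = degree (u.take (shirshovIndex u)) + degree (u.drop (shirshovIndex u)) := by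
        rw [← degree_append, List.take_append_drop]
      rw [e]
      refine Submodule.sub_mem _ (mul_mem_graded h1 h2) (Submodule.smul_mem _ _ ?_)
      rw [add_comm]
      exact mul_mem_graded h2 h1
    · split
      · exact gen_mem_graded _
      · exact Submodule.zero_mem _

lemma skewDeriv_word_mem (i : Fin n) (v : List (Fin n)) :
    skewDeriv Q i ((v.map (gen Q)).prod) ∈
      Submodule.span 𝕜 {x | ∃ v', (i :: v').Perm v ∧ (v'.map (gen Q)).prod = x} := by
  induction v with
  | nil => simp
  | cons j v ih =>
    rw [List.map_cons, List.prod_cons, skewDeriv_mul]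
    refine Submodule.add_mem _ ?_ ?_
    · have := Submodule.mem_map_of_mem (f := LinearMap.mulLeft 𝕜 (gen Q j)) ih
      rw [Submodule.map_span] at this
      refine Submodule.span_mono ?_ this
      rintro _ ⟨_, ⟨v', h, rfl⟩, rfl⟩
      exact ⟨j :: v', (List.Perm.swap _ _ _).trans (h.cons j), by simp⟩
    · rw [skewDeriv_gen]
      split_ifs with h
      · subst h
        have : ∀ v : List (Fin n), ∃ c : 𝕜, scale Q (fun j => (Q i j : 𝕜))
            ((v.map (gen Q)).prod) = c • (v.map (gen Q)).prod := by
          intro v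
          induction v with
          | nil => exact ⟨1, by simp⟩
          | cons k v ih =>
            obtain ⟨c, hc⟩ := ih
            exact ⟨Q i k * c, by simp [hc, smul_smul, mul_comm]⟩
        obtain ⟨c, hc⟩ := this v
        rw [one_mul, hc]
        exact Submodule.smul_mem _ _ (Submodule.subset_span ⟨v, List.Perm.refl _, rfl⟩)
      · simp

lemma coefficient_word_eq_zero (w v : List (Fin n)) (h : ¬ w.Perm v) :
    coefficient Q w ((v.map (gen Q)).prod) = 0 := by
  induction w generalizing v with
  | nil =>
    cases v with
    | nil => simp at h
    | cons i v => simp [coefficient]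
  | cons i w ih =>
    rw [coefficient, LinearMap.comp_apply]
    have := skewDeriv_word_mem (Q := Q) i v
    refine Submodule.span_induction (p := fun x _ => coefficient Q w x = 0) ?_ (by simp)
      (fun x y _ _ hx hy => by simp [hx, hy]) (fun c x _ hx => by simp [hx]) this
    rintro _ ⟨v', hv', rfl⟩
    exact ih v' fun hw => h ((hw.cons i).trans hv')

lemma coefficient_graded_eq_zero {w : List (Fin n)} {α : Fin n → ℕ} (h : degree w ≠ α)
    {x : NicholsAlgebra Q} (hx : x ∈ graded Q α) : coefficient Q w x = 0 := by
  refine Submodule.span_induction (p := fun x _ => coefficient Q w x = 0) ?_ (by simp)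
      (fun x y _ _ hx hy => by simp [hx, hy]) (fun c x _ hx => by simp [hx]) hx
  rintro _ ⟨v, rfl, rfl⟩
  refine coefficient_word_eq_zero w v fun hp => h ?_
  ext i
  exact hp.count_eq i

/-- A homogeneous element in the span of homogeneous elements lies in the span of those of its own
degree. -/
lemma mem_span_inter_graded {α : Fin n → ℕ} {S : Set (NicholsAlgebra Q)}
    (hS : ∀ y ∈ S, ∃ β, y ∈ graded Q β) {x : NicholsAlgebra Q} (hx : x ∈ graded Q α)
    (h : x ∈ Submodule.span 𝕜 S) : x ∈ Submodule.span 𝕜 (S ∩ graded Q α) := by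
  classical
  -- The coefficient functionals of degree α kill all other components and separate the points of
  -- this one, so they replace a projection onto the component.
  let φ : NicholsAlgebra Q →ₗ[𝕜] (List (Fin n) → 𝕜) :=
    LinearMap.pi fun w => if degree w = α then coefficient Q w else 0
  have h1 : φ x ∈ Submodule.span 𝕜 (φ '' (S ∩ graded Q α)) := by
    have := Submodule.mem_map_of_mem (f := φ) h
    rw [Submodule.map_span] at this
    refine Submodule.span_le.mpr ?_ this
    rintro _ ⟨y, hy, rfl⟩
    obtain ⟨β, hβ⟩ := hS y hy
    by_cases hb : β = α
    · subst hb
      exact Submodule.subset_span ⟨y, ⟨hy, hβ⟩, rfl⟩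
    · have : φ y = 0 := by
        ext w
        simp only [φ, LinearMap.pi_apply, Pi.zero_apply]
        split_ifs with hw
        · exact coefficient_graded_eq_zero (by rw [hw]; exact Ne.symm hb) hβ
        · simp
      rw [this]
      exact Submodule.zero_mem _
  rw [← Submodule.map_span] at h1
  obtain ⟨y, hy, hxy⟩ := h1
  have hy' : y ∈ graded Q α :=
    (Submodule.span_le.mpr Set.inter_subset_right : _ ≤ graded Q α) hy
  suffices x - y = 0 by rw [sub_eq_zero] at this; rwa [this]
  refine eq_zero_of_coefficient fun w => ?_
  by_cases hw : degree w = α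
  · have := congrFun hxy w
    simp only [φ, LinearMap.pi_apply, hw, if_true] at this
    rw [map_sub, this, sub_self]
  · exact coefficient_graded_eq_zero hw (Submodule.sub_mem _ hx hy')

end Grading

/-! ### Raising, lowering and braiding operators on a rank-one tensor square -/

section Operators

variable {S : Type*} [CommRing S]

/-- The basis tensor `u_i ⊗ u_j`. -/
def tens (i j : ℕ) : ℕ × ℕ →₀ S := Finsupp.single (i, j) 1

/-- The tensors of total degree `m`. -/
def homTens (S : Type*) [CommRing S] (m : ℕ) : Submodule S (ℕ × ℕ →₀ S) :=
  Finsupp.supported S S {p | p.1 + p.2 = m}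

/-- The raising operator `u_i ⊗ u_j ↦ u_{i+1} ⊗ u_j + q^i a u_i ⊗ u_{j+1}`. -/
def raise (q a : S) : (ℕ × ℕ →₀ S) →ₗ[S] (ℕ × ℕ →₀ S) :=
  Finsupp.linearCombination S fun p => tens (p.1 + 1) p.2 + (q ^ p.1 * a) • tens p.1 (p.2 + 1)

/-- The coefficient `(k)_q (1 - q^{k-1} r)`. -/
def lowerCoeff (q r : S) : ℕ → S
  | 0 => 0
  | k + 1 => q * lowerCoeff q r k + (1 - q ^ (2 * k) * r)

/-- The lowering operator. -/
def lower (q a d : S) : (ℕ × ℕ →₀ S) →ₗ[S] (ℕ × ℕ →₀ S) :=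
  Finsupp.linearCombination S fun p =>
    lowerCoeff q (a * d) p.1 • tens (p.1 - 1) p.2 +
      (q ^ p.1 * d * lowerCoeff q (a * d) p.2) • tens p.1 (p.2 - 1)

/-- The braiding of `u_i ⊗ u_j`. -/
def braidTens (q a d s : S) : ℕ → ℕ → (ℕ × ℕ →₀ S)
  | 0, j => (d ^ j * s) • tens j 0
  | i + 1, j => raise q a (braidTens q a d s i j) - (q ^ i * a) • braidTens q a d s i (j + 1)

/-- The braiding. -/
def braid (q a d s : S) : (ℕ × ℕ →₀ S) →ₗ[S] (ℕ × ℕ →₀ S) :=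
  Finsupp.linearCombination S fun p => braidTens q a d s p.1 p.2

variable (q a d s : S)

lemma tens_apply (i j k l : ℕ) :
    (tens i j : ℕ × ℕ →₀ S) (k, l) = if i = k ∧ j = l then 1 else 0 := by
  rw [tens, Finsupp.single_apply]
  simp [Prod.ext_iff]

@[simp] lemma raise_tens (i j : ℕ) :
    raise q a (tens i j) = tens (i + 1) j + (q ^ i * a) • tens i (j + 1) := by
  simp [raise, tens]

@[simp] lemma lower_tens (i j : ℕ) :
    lower q a d (tens i j) = lowerCoeff q (a * d) i • tens (i - 1) j +
      (q ^ i * d * lowerCoeff q (a * d) j) • tens i (j - 1) := by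
  simp [lower, tens]

@[simp] lemma braid_tens (i j : ℕ) : braid q a d s (tens i j) = braidTens q a d s i j := by
  simp [braid, tens]

/-- The recursive definition is the form produced by commuting lowering past raising; the closed
form shows where the coefficients vanish. -/
lemma lowerCoeff_succ (r : S) (k : ℕ) :
    lowerCoeff q r (k + 1) = (∑ i ∈ Finset.range (k + 1), q ^ i) * (1 - q ^ k * r) := by
  induction k with
  | zero => simp [lowerCoeff]
  | succ k ih =>
    rw [lowerCoeff, ih]
    have h1 : ∑ i ∈ Finset.range (k + 2), q ^ i = 1 + q * ∑ i ∈ Finset.range (k + 1), q ^ i := by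
      rw [Finset.sum_range_succ', Finset.mul_sum, add_comm]
      simp [pow_succ']
    have h2 : ∑ i ∈ Finset.range (k + 2), q ^ i =
        (∑ i ∈ Finset.range (k + 1), q ^ i) + q ^ (k + 1) := Finset.sum_range_succ _ _
    linear_combination (-1 + q ^ (k + 1) * r) * h1 +
      (q ^ (k + 1) * r) * (h2 - h1)

lemma mem_homTens {m : ℕ} {t : ℕ × ℕ →₀ S} :
    t ∈ homTens S m ↔ ∀ i j, i + j ≠ m → t (i, j) = 0 := by
  rw [homTens, Finsupp.mem_supported']
  simp

lemma tens_mem_homTens (i j : ℕ) : (tens i j : ℕ × ℕ →₀ S) ∈ homTens S (i + j) :=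
  Finsupp.single_mem_supported S _ rfl

lemma tens_mem_homTens' {i j m : ℕ} (h : i + j = m) : (tens i j : ℕ × ℕ →₀ S) ∈ homTens S m :=
  h ▸ tens_mem_homTens i j

/-- A linear map sending basis tensors with index in `s` into `N` sends everything supported on `s`
into `N`. -/
lemma map_supported_mem {M : Type*} [AddCommGroup M] [Module S M] {N : Submodule S M}
    (f : (ℕ × ℕ →₀ S) →ₗ[S] M) {A : Set (ℕ × ℕ)} (h : ∀ i j, (i, j) ∈ A → f (tens i j) ∈ N)
    {t : ℕ × ℕ →₀ S} (ht : t ∈ Finsupp.supported S S A) : f t ∈ N := by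
  rw [Finsupp.supported_eq_span_single] at ht
  have : Submodule.span S ((fun i => Finsupp.single i (1 : S)) '' A) ≤ N.comap f := by
    rw [Submodule.span_le]
    rintro _ ⟨⟨i, j⟩, hp, rfl⟩
    exact h i j hp
  exact this ht

lemma map_supported_eq {M : Type*} [AddCommGroup M] [Module S M]
    (f g : (ℕ × ℕ →₀ S) →ₗ[S] M) {A : Set (ℕ × ℕ)}
    (h : ∀ i j, (i, j) ∈ A → f (tens i j) = g (tens i j))
    {t : ℕ × ℕ →₀ S} (ht : t ∈ Finsupp.supported S S A) : f t = g t := by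
  have := map_supported_mem (N := ⊥) (f - g) (fun i j hp => by simp [h i j hp]) ht
  simpa [sub_eq_zero] using this

lemma tens_hom_ext {M : Type*} [AddCommGroup M] [Module S M] {f g : (ℕ × ℕ →₀ S) →ₗ[S] M}
    (h : ∀ i j, f (tens i j) = g (tens i j)) : f = g :=
  LinearMap.ext fun t => map_supported_eq f g (A := Set.univ) (fun i j _ => h i j)
    (by simp [Finsupp.supported_univ])

lemma raise_mem {m : ℕ} {t : ℕ × ℕ →₀ S} (ht : t ∈ homTens S m) :
    raise q a t ∈ homTens S (m + 1) := by
  refine map_supported_mem _ (fun i j hij => ?_) ht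
  have : i + j = m := hij
  rw [raise_tens]
  exact Submodule.add_mem _ (tens_mem_homTens' (by omega))
    (Submodule.smul_mem _ _ (tens_mem_homTens' (by omega)))

lemma lower_mem {m : ℕ} {t : ℕ × ℕ →₀ S} (ht : t ∈ homTens S (m + 1)) :
    lower q a d t ∈ homTens S m := by
  refine map_supported_mem _ (fun i j hij => ?_) ht
  have : i + j = m + 1 := hij
  rw [lower_tens]
  refine Submodule.add_mem _ ?_ ?_
  · cases i with
    | zero => simp [lowerCoeff]
    | succ i => exact Submodule.smul_mem _ _ (tens_mem_homTens' (by omega))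
  · cases j with
    | zero => simp [lowerCoeff]
    | succ j => exact Submodule.smul_mem _ _ (tens_mem_homTens' (by omega))

lemma braidTens_mem (i j : ℕ) : braidTens q a d s i j ∈ homTens S (i + j) := by
  induction i generalizing j with
  | zero => exact Submodule.smul_mem _ _ (tens_mem_homTens' (by omega))
  | succ i ih =>
    refine Submodule.sub_mem _ ?_ (Submodule.smul_mem _ _ ?_)
    · have := raise_mem q a (ih j)
      rwa [add_right_comm] at this
    · have := ih (j + 1)
      rwa [← add_assoc, add_right_comm] at this

lemma braid_mem {m : ℕ} {t : ℕ × ℕ →₀ S} (ht : t ∈ homTens S m) :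
    braid q a d s t ∈ homTens S m := by
  refine map_supported_mem _ (fun i j hij => ?_) ht
  have : i + j = m := hij
  rw [braid_tens, ← this]
  exact braidTens_mem q a d s i j

/-- The q-commutation rule replacing the sl_2 relation. The scalar depends on the total degree only,
which makes the operators usable on all tensors of one degree. -/
lemma lower_raise_tens (i j : ℕ) : lower q a d (raise q a (tens i j)) =
    q • raise q a (lower q a d (tens i j)) +
      (1 - q ^ (2 * (i + j)) * (a * d) ^ 2) • tens i j := by
  simp only [raise_tens, lower_tens, map_add, map_smul]
  rcases i with _ | i <;> rcases j with _ | j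
  · simp [lowerCoeff]
    module
  · simp only [lowerCoeff, Nat.add_sub_cancel]
    simp
    module
  · simp only [lowerCoeff, Nat.add_sub_cancel]
    simp
    module
  · simp only [lowerCoeff, Nat.add_sub_cancel]
    module

lemma lower_raise {m : ℕ} {t : ℕ × ℕ →₀ S} (ht : t ∈ homTens S m) :
    lower q a d (raise q a t) = q • raise q a (lower q a d t) +
      (1 - q ^ (2 * m) * (a * d) ^ 2) • t := by
  refine map_supported_eq (lower q a d ∘ₗ raise q a)
    (q • (raise q a ∘ₗ lower q a d) + (1 - q ^ (2 * m) * (a * d) ^ 2) • LinearMap.id)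
    (fun i j hij => ?_) ht
  have : i + j = m := hij
  simpa [← this] using lower_raise_tens q a d i j

/-- Built into the recursion defining `braidTens`. -/
lemma braid_raise (t : ℕ × ℕ →₀ S) :
    braid q a d s (raise q a t) = raise q a (braid q a d s t) := by
  have : braid q a d s ∘ₗ raise q a = raise q a ∘ₗ braid q a d s :=
    tens_hom_ext fun i j => by simp [braidTens]
  exact DFunLike.congr_fun this t

lemma lower_braid (t : ℕ × ℕ →₀ S) :
    lower q a d (braid q a d s t) = braid q a d s (lower q a d t) := by
  suffices h : lower q a d ∘ₗ braid q a d s = braid q a d s ∘ₗ lower q a d from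
    DFunLike.congr_fun h t
  refine tens_hom_ext fun i j => ?_
  simp only [LinearMap.comp_apply]
  induction i generalizing j with
  | zero =>
    rw [braid_tens, braidTens, map_smul, lower_tens, lower_tens]
    cases j with
    | zero => simp [lowerCoeff]
    | succ j =>
      simp only [lowerCoeff, zero_smul, map_smul, braid_tens, braidTens, mul_zero, zero_add,
        add_zero, Nat.add_sub_cancel, smul_smul]
      congr 1
      ring
  | succ i ih =>
    -- The first index is reduced by writing the tensor through the raising operator. Moving `lower`
    -- past `raise` gives the same scalar before and after braiding, since the braiding preserves
    -- the degree.
    have h1 : (tens (i + 1) j : ℕ × ℕ →₀ S) =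
        raise q a (tens i j) - (q ^ i * a) • tens i (j + 1) := by simp
    rw [h1]
    simp only [map_sub, map_smul, ih, braid_raise]
    rw [lower_raise q a d (braid_mem q a d s (tens_mem_homTens i j)), ih,
      lower_raise q a d (tens_mem_homTens i j), map_add, map_smul, map_smul, braid_raise]

lemma raise_apply (t : ℕ × ℕ →₀ S) (k l : ℕ) : raise q a t (k, l) =
    (if k = 0 then 0 else t (k - 1, l)) + (if l = 0 then 0 else q ^ k * a * t (k, l - 1)) := by
  let f : (ℕ × ℕ →₀ S) →ₗ[S] S := Finsupp.lapply (k, l) ∘ₗ raise q a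
  let g : (ℕ × ℕ →₀ S) →ₗ[S] S := (if k = 0 then 0 else Finsupp.lapply (k - 1, l)) +
    (if l = 0 then 0 else (q ^ k * a) • Finsupp.lapply (k, l - 1))
  have h : f = g := by
    refine tens_hom_ext fun i j => ?_
    simp only [f, g, LinearMap.comp_apply, raise_tens, LinearMap.add_apply,
      Finsupp.lapply_apply, Finsupp.add_apply, Finsupp.smul_apply, tens_apply, smul_eq_mul]
    rcases k with _ | k <;> rcases l with _ | l <;>
      simp [tens_apply] <;> (try split_ifs with h) <;> simp_all
  have := DFunLike.congr_fun h t
  simp only [f, g, LinearMap.comp_apply, LinearMap.add_apply, Finsupp.lapply_apply] at this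
  rw [this]
  congr 1 <;> split_ifs <;> simp

lemma lower_apply (t : ℕ × ℕ →₀ S) (k l : ℕ) : lower q a d t (k, l) =
    lowerCoeff q (a * d) (k + 1) * t (k + 1, l) +
      q ^ k * d * lowerCoeff q (a * d) (l + 1) * t (k, l + 1) := by
  let f : (ℕ × ℕ →₀ S) →ₗ[S] S := Finsupp.lapply (k, l) ∘ₗ lower q a d
  let g : (ℕ × ℕ →₀ S) →ₗ[S] S := lowerCoeff q (a * d) (k + 1) • Finsupp.lapply (k + 1, l) +
    (q ^ k * d * lowerCoeff q (a * d) (l + 1)) • Finsupp.lapply (k, l + 1)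
  have h : f = g := by
    refine tens_hom_ext fun i j => ?_
    simp only [f, g, LinearMap.comp_apply, lower_tens, LinearMap.add_apply, LinearMap.smul_apply,
      Finsupp.lapply_apply, Finsupp.add_apply, Finsupp.smul_apply, tens_apply, smul_eq_mul]
    congr 1
    · rcases i with _ | i
      · simp [lowerCoeff]
      · by_cases h : i = k
        · subst h; simp
        · simp [h]
    · rcases j with _ | j
      · simp [lowerCoeff]
      · by_cases h : i = k
        · subst h
          by_cases h' : j = l
          · subst h'; simp
          · simp [h']
        · simp [h]
  simpa [f, g] using DFunLike.congr_fun h t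

/-- The coefficient of the image at (i + 1, j) is t (i, j) plus a multiple of t (i + 1, j - 1), so
induction on the second index recovers t without assumptions on the parameters. -/
lemma raise_injective : Function.Injective (raise q a) := by
  rw [injective_iff_map_eq_zero]
  intro t ht
  have h : ∀ j i, t (i, j) = 0 := by
    intro j
    induction j with
    | zero =>
      intro i
      have := raise_apply q a t (i + 1) 0
      simpa [ht] using this.symm
    | succ j ih =>
      intro i
      have := raise_apply q a t (i + 1) (j + 1)
      simpa [ht, ih] using this.symm
  ext ⟨i, j⟩
  exact h j i

/-- Triangularity: in the recursion the subtracted term starts at first index j + 1, so only the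
raised term reaches the extreme coefficient. -/
lemma braidTens_apply (i j : ℕ) : (∀ k l, k < j → braidTens q a d s i j (k, l) = 0) ∧
    braidTens q a d s i j (j, i) = s * d ^ j * (q ^ j * a) ^ i := by
  induction i generalizing j with
  | zero =>
    constructor
    · intro k l hk
      simp [braidTens, tens_apply, hk.ne']
    · simp [braidTens, tens_apply, mul_comm]
  | succ i ih =>
    constructor
    · intro k l hk
      simp only [braidTens, Finsupp.sub_apply, Finsupp.smul_apply, raise_apply]
      rw [(ih (j + 1)).1 k l (by omega), (ih j).1 (k - 1) l (by omega), (ih j).1 k (l - 1) hk]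
      simp
    · simp only [braidTens, Finsupp.sub_apply, Finsupp.smul_apply, raise_apply]
      rw [(ih (j + 1)).1 j (i + 1) (by omega)]
      simp only [Nat.add_sub_cancel, (ih j).2]
      have : (if j = 0 then 0 else braidTens q a d s i j (j - 1, i + 1)) = 0 := by
        split_ifs with h
        · rfl
        · exact (ih j).1 _ _ (by omega)
      rw [this]
      simp
      ring

/-- The lowest coefficient of the braiding of a tensor with given highest coefficient. -/
lemma braid_apply_low {A B : ℕ} {t : ℕ × ℕ →₀ S} (ht : t ∈ homTens S (A + B))
    (hA : ∀ i j, A < i → t (i, j) = 0) :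
    braid q a d s t (B, A) = s * d ^ B * (q ^ B * a) ^ A * t (A, B) := by
  refine map_supported_eq (Finsupp.lapply (B, A) ∘ₗ braid q a d s)
    ((s * d ^ B * (q ^ B * a) ^ A) • Finsupp.lapply (A, B))
    (A := {p | p.1 + p.2 = A + B ∧ p.1 ≤ A}) (fun i j hij => ?_) ?_
  · obtain ⟨h1, h2⟩ : i + j = A + B ∧ i ≤ A := hij
    simp only [LinearMap.comp_apply, braid_tens, Finsupp.lapply_apply, LinearMap.smul_apply,
      tens_apply]
    rcases h2.eq_or_lt with rfl | h2
    · obtain rfl : j = B := by omega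
      simp [(braidTens_apply q a d s i j).2]
    · rw [(braidTens_apply q a d s i j).1 B A (by omega)]
      simp [h2.ne]
  · rw [Finsupp.mem_supported']
    rintro ⟨i, j⟩ hij
    by_cases h : i + j = A + B
    · refine hA i j ?_
      by_contra h'
      exact hij ⟨h, not_lt.mp h'⟩
    · exact mem_homTens.mp ht i j h

/-! ### Lowest weight vectors -/

/-- The coefficients of the lowest weight vector of degree `m`. -/
def lowestCoeff (m : ℕ) : ℕ → S
  | 0 => 1
  -- The recursion solves the equation that the lowered tensor has zero coefficient at (i, m - i -
  -- 1). `Ring.inverse` allows the dual numbers as coefficients.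
  | i + 1 => -(q ^ i * d * lowerCoeff q (a * d) (m - i)) * lowestCoeff m i *
      Ring.inverse (lowerCoeff q (a * d) (i + 1))

/-- The lowest weight vector of degree `m`. -/
def lowest (m : ℕ) : ℕ × ℕ →₀ S :=
  ∑ i ∈ Finset.range (m + 1), lowestCoeff q a d m i • tens i (m - i)

lemma lowest_mem (m : ℕ) : lowest q a d m ∈ homTens S m :=
  Submodule.sum_mem _ fun i hi => Submodule.smul_mem _ _
    (tens_mem_homTens' (by have := Finset.mem_range.mp hi; omega))

lemma lowest_apply {m i j : ℕ} (h : i + j = m) :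
    lowest q a d m (i, j) = lowestCoeff q a d m i := by
  rw [lowest, Finsupp.finsetSum_apply, Finset.sum_eq_single i]
  · simp [tens_apply, ← h]
  · intro k _ hk
    simp [tens_apply, hk]
  · intro hi
    exact absurd (Finset.mem_range.mpr (by omega)) hi

lemma lowest_apply_zero (m : ℕ) : lowest q a d m (0, m) = 1 := by
  rw [lowest_apply q a d (zero_add m), lowestCoeff]

variable {q a d} in
lemma lower_lowest {m : ℕ} (hu : ∀ k, k < m → IsUnit (lowerCoeff q (a * d) (k + 1))) :
    lower q a d (lowest q a d m) = 0 := by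
  ext ⟨k, l⟩
  rw [lower_apply, Finsupp.zero_apply]
  by_cases h : k + l + 1 = m
  · rw [lowest_apply q a d (by omega), lowest_apply q a d (by omega), lowestCoeff]
    have hl : m - k = l + 1 := by omega
    rw [hl]
    have := Ring.mul_inverse_cancel _ (hu k (by omega))
    linear_combination (-(q ^ k * d * lowerCoeff q (a * d) (l + 1)) * lowestCoeff q a d m k) * this
  · rw [mem_homTens.mp (lowest_mem q a d m) _ _ (by omega),
      mem_homTens.mp (lowest_mem q a d m) _ _ (by omega)]
    simp

variable {q a d} in
-- Vanishing under `lower` is a two-term recursion with unit leading factor, so the coefficient at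
-- (0, m) determines the tensor. Hence the lowest weight vectors of degree m form a free module of
-- rank one.
lemma eq_zero_of_lower {m : ℕ} (hu : ∀ k, k < m → IsUnit (lowerCoeff q (a * d) (k + 1)))
    {t : ℕ × ℕ →₀ S} (ht : t ∈ homTens S m) (hl : lower q a d t = 0) (h0 : t (0, m) = 0) :
    t = 0 := by
  have key : ∀ i j, i + j = m → t (i, j) = 0 := by
    intro i
    induction i with
    | zero => intro j hj; rwa [← hj, zero_add] at h0
    | succ i ih =>
      intro j hj
      have := lower_apply q a d t i j
      rw [hl, ih (j + 1) (by omega)] at this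
      simp only [Finsupp.coe_zero, Pi.zero_apply, mul_zero, add_zero] at this
      exact (hu i (by omega)).mul_right_eq_zero.mp this.symm
  ext ⟨i, j⟩
  by_cases h : i + j = m
  · exact key i j h
  · exact mem_homTens.mp ht i j h

variable {q a d} in
lemma eq_smul_lowest {m : ℕ} (hu : ∀ k, k < m → IsUnit (lowerCoeff q (a * d) (k + 1)))
    {t : ℕ × ℕ →₀ S} (ht : t ∈ homTens S m) (hl : lower q a d t = 0) :
    t = t (0, m) • lowest q a d m := by
  rw [← sub_eq_zero]
  refine eq_zero_of_lower hu (Submodule.sub_mem _ ht (Submodule.smul_mem _ _ (lowest_mem q a d m)))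
    ?_ ?_
  · rw [map_sub, map_smul, hl, lower_lowest hu, smul_zero, sub_zero]
  · simp [lowest_apply_zero]

variable {q a d} in
-- In the full product the numerators y_m, …, y_1 and the denominators y_1, …, y_m cancel, leaving
-- signs and powers.
lemma lowestCoeff_self {m : ℕ} (hu : ∀ k, k < m → IsUnit (lowerCoeff q (a * d) (k + 1))) :
    lowestCoeff q a d m m = (-d) ^ m * q ^ (m * (m - 1) / 2) := by
  have key : ∀ k, k ≤ m → lowestCoeff q a d m k *
      ∏ i ∈ Finset.range k, lowerCoeff q (a * d) (i + 1) =
      (-d) ^ k * q ^ (∑ i ∈ Finset.range k, i) *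
        ∏ i ∈ Finset.range k, lowerCoeff q (a * d) (m - i) := by
    intro k hk
    induction k with
    | zero => simp [lowestCoeff]
    | succ k ih =>
      rw [Finset.prod_range_succ, Finset.prod_range_succ, Finset.sum_range_succ, lowestCoeff]
      have h1 := Ring.mul_inverse_cancel _ (hu k (by omega))
      have h2 := ih (by omega)
      rw [pow_add]
      set P := ∏ i ∈ Finset.range k, lowerCoeff q (a * d) (i + 1)
      linear_combination (-(q ^ k * d * lowerCoeff q (a * d) (m - k)) *
        lowestCoeff q a d m k * P) * h1 +
        (-(q ^ k * d * lowerCoeff q (a * d) (m - k))) * h2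
  have h := key m le_rfl
  rw [← Finset.prod_range_reflect, Finset.sum_range_id] at h
  have hp : ∏ j ∈ Finset.range m, lowerCoeff q (a * d) (m - 1 - j + 1) =
      ∏ i ∈ Finset.range m, lowerCoeff q (a * d) (m - i) :=
    Finset.prod_congr rfl fun i hi => by
      have := Finset.mem_range.mp hi
      congr 1; omega
  rw [hp] at h
  have hunit : IsUnit (∏ i ∈ Finset.range m, lowerCoeff q (a * d) (m - i)) := by
    rw [← hp]
    refine (Finset.prod_induction _ IsUnit (fun _ _ => IsUnit.mul) isUnit_one) fun j hj => ?_
    have := Finset.mem_range.mp hj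
    exact hu _ (by omega)
  exact hunit.mul_right_cancel h

variable {q a d} in
/-- Lowest weight vectors are eigenvectors of the braiding. -/
lemma braid_lowest {m : ℕ} (hu : ∀ k, k < m → IsUnit (lowerCoeff q (a * d) (k + 1))) :
    braid q a d s (lowest q a d m) =
      (q ^ (m * (m - 1) / 2) * (-(a * d)) ^ m * s) • lowest q a d m := by
  have h := eq_smul_lowest hu (braid_mem q a d s (lowest_mem q a d m))
    (by rw [lower_braid, lower_lowest hu, map_zero])
  rw [h]
  congr 1
  -- The eigenvalue is the coefficient at (0, m), to which only the coefficient at (m, 0) before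
  -- braiding contributes.
  rw [braid_apply_low q a d s (A := m) (B := 0) (lowest_mem q a d m)
    (fun i j hi => mem_homTens.mp (lowest_mem q a d m) i j (by omega)),
    lowest_apply q a d (add_zero m), lowestCoeff_self hu, ← mul_neg, mul_pow]
  ring

lemma raise_pow_mem {n : ℕ} {t : ℕ × ℕ →₀ S} (ht : t ∈ homTens S n) (k : ℕ) :
    (raise q a ^ k) t ∈ homTens S (n + k) := by
  induction k with
  | zero => simpa using ht
  | succ k ih => rw [pow_succ', Module.End.mul_apply, ← add_assoc]; exact raise_mem q a ih

lemma braid_raise_pow (t : ℕ × ℕ →₀ S) (k : ℕ) :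
    braid q a d s ((raise q a ^ k) t) = (raise q a ^ k) (braid q a d s t) := by
  induction k with
  | zero => simp
  | succ k ih => simp only [pow_succ', Module.End.mul_apply, braid_raise, ih]

/-- The string above a lowest weight vector of degree n obeys the recursion of the y_k, with r
replaced by q^{2n} r^2. -/
lemma lower_raise_pow {n : ℕ} {t : ℕ × ℕ →₀ S} (ht : t ∈ homTens S n)
    (hl : lower q a d t = 0) (k : ℕ) : lower q a d ((raise q a ^ (k + 1)) t) =
      lowerCoeff q (q ^ (2 * n) * (a * d) ^ 2) (k + 1) • (raise q a ^ k) t := by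
  induction k with
  | zero =>
    rw [zero_add, pow_one, lower_raise q a d ht, hl]
    simp [lowerCoeff]
  | succ k ih =>
    rw [pow_succ', Module.End.mul_apply, lower_raise q a d (raise_pow_mem q a ht _), ih,
      map_smul, ← Module.End.mul_apply, ← pow_succ', smul_smul, ← add_smul]
    congr 1
    conv_rhs => rw [lowerCoeff]
    ring

lemma raise_pow_apply_zero (t : ℕ × ℕ →₀ S) (j k : ℕ) :
    (raise q a ^ k) t (0, j + k) = a ^ k * t (0, j) := by
  induction k with
  | zero => simp
  | succ k ih =>
    rw [pow_succ', Module.End.mul_apply, raise_apply, ← add_assoc]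
    simp [ih, pow_succ']
    ring

end Operators

/-! ### Base change and infinitesimal deformation -/

section BaseChange

variable {S S' : Type*} [CommRing S] [CommRing S'] (f : S →+* S')

/-- Base change of tensors. -/
def baseChange : (ℕ × ℕ →₀ S) →+ (ℕ × ℕ →₀ S') :=
  Finsupp.mapRange.addMonoidHom f.toAddMonoidHom

lemma baseChange_apply (t : ℕ × ℕ →₀ S) (p : ℕ × ℕ) : baseChange f t p = f (t p) := rfl

@[simp] lemma baseChange_smul (c : S) (t : ℕ × ℕ →₀ S) :
    baseChange f (c • t) = f c • baseChange f t := by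
  ext p; simp [baseChange_apply]

@[simp] lemma baseChange_tens (i j : ℕ) : baseChange f (tens i j) = tens i j := by
  ext ⟨k, l⟩
  rw [baseChange_apply, tens_apply, tens_apply]
  split_ifs <;> simp

lemma baseChange_comm (φ : (ℕ × ℕ →₀ S) →ₗ[S] (ℕ × ℕ →₀ S))
    (ψ : (ℕ × ℕ →₀ S') →ₗ[S'] (ℕ × ℕ →₀ S'))
    (h : ∀ i j, baseChange f (φ (tens i j)) = ψ (tens i j)) (t : ℕ × ℕ →₀ S) :
    baseChange f (φ t) = ψ (baseChange f t) := by
  induction t using Finsupp.induction_linear with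
  | zero => simp
  | add x y hx hy => simp [hx, hy]
  | single p c =>
    have : Finsupp.single p c = c • (tens p.1 p.2 : ℕ × ℕ →₀ S) := by simp [tens]
    rw [this]
    simp [h]

lemma baseChange_raise (q a : S) (t : ℕ × ℕ →₀ S) :
    baseChange f (raise q a t) = raise (f q) (f a) (baseChange f t) :=
  baseChange_comm f _ _ (fun i j => by simp) t

lemma map_lowerCoeff (q r : S) (k : ℕ) :
    f (lowerCoeff q r k) = lowerCoeff (f q) (f r) k := by
  induction k with
  | zero => simp [lowerCoeff]
  | succ k ih => simp [lowerCoeff, ih]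

lemma baseChange_lower (q a d : S) (t : ℕ × ℕ →₀ S) :
    baseChange f (lower q a d t) = lower (f q) (f a) (f d) (baseChange f t) :=
  baseChange_comm f _ _ (fun i j => by simp [map_lowerCoeff]) t

lemma baseChange_braid (q a d s : S) (t : ℕ × ℕ →₀ S) :
    baseChange f (braid q a d s t) = braid (f q) (f a) (f d) (f s) (baseChange f t) := by
  refine baseChange_comm f _ _ (fun i j => ?_) t
  rw [braid_tens, braid_tens]
  induction i generalizing j with
  | zero => simp [braidTens]
  | succ i ih => simp [braidTens, baseChange_raise, ih]

lemma baseChange_mem {m : ℕ} {t : ℕ × ℕ →₀ S} (ht : t ∈ homTens S m) :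
    baseChange f t ∈ homTens S' m :=
  mem_homTens.mpr fun i j h => by rw [baseChange_apply, mem_homTens.mp ht i j h, map_zero]

lemma baseChange_raise_pow (q a : S) (t : ℕ × ℕ →₀ S) (k : ℕ) :
    baseChange f ((raise q a ^ k) t) = (raise (f q) (f a) ^ k) (baseChange f t) := by
  induction k with
  | zero => simp
  | succ k ih => simp only [pow_succ', Module.End.mul_apply, baseChange_raise, ih]

/-- Follows from uniqueness up to the coefficient at (0, m); the unit hypothesis is needed because
`Ring.inverse` is compatible with ring maps only on units. -/
lemma baseChange_lowest {q a d : S} {m : ℕ}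
    (hu : ∀ k, k < m → IsUnit (lowerCoeff q (a * d) (k + 1))) :
    baseChange f (lowest q a d m) = lowest (f q) (f a) (f d) m := by
  have hu' : ∀ k, k < m → IsUnit (lowerCoeff (f q) (f a * f d) (k + 1)) := fun k hk => by
    rw [← map_mul, ← map_lowerCoeff]
    exact (hu k hk).map f
  have := eq_smul_lowest hu' (baseChange_mem f (lowest_mem q a d m))
    (by rw [← baseChange_lower, lower_lowest hu, map_zero])
  rwa [baseChange_apply, lowest_apply_zero, map_one, one_smul] at this

end BaseChange

section Dual

variable {𝕜 : Type*} [Field 𝕜]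

lemma eps_smul_eq_zero {t : ℕ × ℕ →₀ DualNumber 𝕜}
    (h : (DualNumber.eps : DualNumber 𝕜) • t = 0) :
    baseChange (TrivSqZeroExt.fstHom 𝕜 𝕜 𝕜 : DualNumber 𝕜 →+* 𝕜) t = 0 := by
  ext p
  have := congrArg TrivSqZeroExt.snd (DFunLike.congr_fun h p)
  simpa [baseChange_apply] using this

lemma exists_eq_eps_smul {t : ℕ × ℕ →₀ DualNumber 𝕜}
    (h : baseChange (TrivSqZeroExt.fstHom 𝕜 𝕜 𝕜 : DualNumber 𝕜 →+* 𝕜) t = 0) :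
    ∃ w : ℕ × ℕ →₀ 𝕜, t = (DualNumber.eps : DualNumber 𝕜) •
      baseChange (TrivSqZeroExt.inlHom 𝕜 𝕜) w := by
  refine ⟨Finsupp.mapRange TrivSqZeroExt.snd rfl t, ?_⟩
  ext p
  · have := DFunLike.congr_fun h p
    simpa [baseChange_apply] using this
  · simp only [baseChange_apply, Finsupp.smul_apply, smul_eq_mul, DualNumber.snd_mul]
    simp
    rfl

variable {q a d s : 𝕜}

lemma isUnit_lowerCoeff {m : ℕ} (hy : ∀ k, k < m → lowerCoeff q (a * d) (k + 1) ≠ 0) :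
    ∀ k, k < m → IsUnit (lowerCoeff q (a * d) (k + 1)) := fun k hk => (hy k hk).isUnit

/-- If the raising operator maps a lowest weight vector to a lowest weight vector, the latter is
the standard one up to a scalar. -/
lemma raise_pow_lowest {n k : ℕ}
    (hy : ∀ i, i < n + (k + 1) → lowerCoeff q (a * d) (i + 1) ≠ 0)
    (h1 : q ^ (2 * n + k) * (a * d) ^ 2 = 1) :
    (raise q a ^ (k + 1)) (lowest q a d n) = a ^ (k + 1) • lowest q a d (n + (k + 1)) := by
  have hu := isUnit_lowerCoeff hy
  have := eq_smul_lowest hu (raise_pow_mem q a (lowest_mem q a d n) (k + 1)) (by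
    rw [lower_raise_pow q a d (lowest_mem q a d n) (lower_lowest fun i hi => hu i (by omega)),
      lowerCoeff_succ]
    have : q ^ k * (q ^ (2 * n) * (a * d) ^ 2) = 1 := by rw [← h1]; ring
    rw [this]; simp)
  rwa [raise_pow_apply_zero, lowest_apply_zero, mul_one] at this

/-- In the resonant case the eigenvalue `-1` of the braiding comes with a Jordan block. -/
lemma exists_jordan {n k : ℕ} (ha : a ≠ 0)
    (hy : ∀ i, i < n + (k + 1) → lowerCoeff q (a * d) (i + 1) ≠ 0)
    (h1 : q ^ (2 * n + k) * (a * d) ^ 2 = 1)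
    (hn : q ^ (n * (n - 1) / 2) * (-(a * d)) ^ n * s = -1) :
    ∃ w ∈ homTens 𝕜 (n + (k + 1)),
      lower q a d w = (-2 * ∑ i ∈ Finset.range (k + 1), q ^ i) •
        (raise q a ^ k) (lowest q a d n) ∧
      w + braid q a d s w =
        (((k + 1 : ℕ) : 𝕜) * a ^ (k + 1)) • lowest q a d (n + (k + 1)) := by
  have hu := isUnit_lowerCoeff hy
  have hrl := raise_pow_lowest hy h1
  set m := n + (k + 1) with hm
  -- The raised v_n is a nonzero multiple of v_m and raising commutes with the braiding, so both
  -- have eigenvalue -1.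
  have hεm : q ^ (m * (m - 1) / 2) * (-(a * d)) ^ m * s = -1 := by
    have h2 := congrArg (braid q a d s) hrl
    rw [braid_raise_pow, braid_lowest s fun i hi => hu i (by omega), map_smul, map_smul,
      braid_lowest s hu, hn, hrl] at h2
    have h3 := DFunLike.congr_fun h2 (0, m)
    simp only [Finsupp.smul_apply, lowest_apply_zero, smul_eq_mul, mul_one] at h3
    have := mul_left_cancel₀ (pow_ne_zero (k + 1) ha) (h3.symm.trans (mul_comm _ _))
    exact this
  let E : DualNumber 𝕜 := DualNumber.eps
  have hE : E * E = 0 := DualNumber.eps_mul_eps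
  have hpow : ∀ j : ℕ, (1 + E) ^ j = 1 + j * E := by
    intro j
    induction j with
    | zero => simp
    | succ j ih =>
      rw [pow_succ, ih]
      push_cast
      linear_combination (j : DualNumber 𝕜) * hE
  let ι : 𝕜 →+* DualNumber 𝕜 := TrivSqZeroExt.inlHom 𝕜 𝕜
  let π : DualNumber 𝕜 →+* 𝕜 := (TrivSqZeroExt.fstHom 𝕜 𝕜 𝕜 : DualNumber 𝕜 →+* 𝕜)
  have hπι : ∀ x, π (ι x) = x := fun x => rfl
  have hπE : π E = 0 := rfl
  have hπa : π (ι a * (1 + E)) = a := by rw [map_mul, hπι, map_add, hπE]; simp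
  -- The parameter a is deformed to a (1 + ε), all others being kept. Units of the dual numbers are
  -- detected modulo ε, so the lowest weight theory persists.
  have hu' : ∀ i, i < m → IsUnit (lowerCoeff (ι q) (ι a * (1 + E) * ι d) (i + 1)) := by
    intro i hi
    rw [TrivSqZeroExt.isUnit_iff_isUnit_fst]
    suffices h : IsUnit (π (lowerCoeff (ι q) (ι a * (1 + E) * ι d) (i + 1))) from h
    rw [map_lowerCoeff, map_mul, hπa, hπι, hπι]
    exact hu i hi
  -- The eigenvalue in degree j moves with speed proportional to j. The two coinciding eigenvalues,
  -- in degrees n and m, thus separate at first order.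
  have hev : ∀ j : ℕ, (ι q) ^ (j * (j - 1) / 2) * (-(ι a * (1 + E) * ι d)) ^ j * ι s =
      ι (q ^ (j * (j - 1) / 2) * (-(a * d)) ^ j * s) * (1 + j * E) := by
    intro j
    rw [← hpow]
    simp only [map_mul, map_pow, map_neg]
    have : (-(ι a * (1 + E) * ι d)) = (-(ι a * ι d)) * (1 + E) := by ring
    rw [this, mul_pow]
    ring
  have bl := fun (j : ℕ) (hj : j ≤ m) => braid_lowest (ι s) (q := ι q) (a := ι a * (1 + E))
    (d := ι d) (m := j) fun i hi => hu' i (by omega)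
  have redl : ∀ j, j ≤ m → baseChange π (lowest (ι q) (ι a * (1 + E)) (ι d) j) =
      lowest q a d j := by
    intro j hj
    rw [baseChange_lowest π fun i hi => hu' i (by omega), hπa, hπι, hπι]
  set vn := lowest (ι q) (ι a * (1 + E)) (ι d) n with hvn
  set vm := lowest (ι q) (ι a * (1 + E)) (ι d) m with hvm
  set xn := (raise (ι q) (ι a * (1 + E)) ^ (k + 1)) vn with hxn
  have redxn : baseChange π xn = a ^ (k + 1) • lowest q a d m := by
    rw [hxn, baseChange_raise_pow, redl n (by omega), hπa, hπι, hrl]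
  -- Modulo ε the raised vector and the multiple of v_m agree, so their difference is divisible by
  -- ε; the quotient w is the missing direction.
  obtain ⟨w, hw⟩ := exists_eq_eps_smul (t := xn - (ι a * (1 + E)) ^ (k + 1) • vm) (by
    change baseChange π _ = 0
    rw [map_sub, redxn, baseChange_smul, redl m le_rfl, map_pow, hπa, sub_self])
  change _ = E • baseChange ι w at hw
  have redw : baseChange π (baseChange ι w) = w := by
    ext p; rfl
  have hmem : w ∈ homTens 𝕜 m := by
    rw [mem_homTens]
    intro i j hij
    have h2 := DFunLike.congr_fun hw (i, j)
    rw [Finsupp.sub_apply, Finsupp.smul_apply, mem_homTens.mp (lowest_mem _ _ _ m) i j hij,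
      mem_homTens.mp (raise_pow_mem _ _ (lowest_mem _ _ _ n) (k + 1)) i j hij] at h2
    have h3 := congrArg TrivSqZeroExt.snd h2
    simpa [E, ι, baseChange_apply] using h3.symm
  refine ⟨w, hmem, ?_, ?_⟩
  · have h2 := congrArg (lower (ι q) (ι a * (1 + E)) (ι d)) hw
    rw [map_sub, map_smul, map_smul, lower_lowest hu', smul_zero, sub_zero, hxn,
      lower_raise_pow _ _ _ (lowest_mem _ _ _ n) (lower_lowest fun i hi => hu' i (by omega)),
      lowerCoeff_succ] at h2
    -- The resonance is quadratic in a, whence the factor -2 in the lowering of w.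
    have h3 : (ι q) ^ k * ((ι q) ^ (2 * n) * (ι a * (1 + E) * ι d) ^ 2) = 1 + 2 * E := by
      have := congrArg ι h1
      simp only [map_mul, map_pow, map_one] at this
      have h4 := hpow 2
      push_cast at h4
      rw [← h4]
      linear_combination (1 + E) ^ 2 * this
    rw [h3] at h2
    have h4 : (∑ i ∈ Finset.range (k + 1), (ι q) ^ i) * (1 - (1 + 2 * E)) =
        E * ι (-2 * ∑ i ∈ Finset.range (k + 1), q ^ i) := by
      simp only [map_mul, map_sum, map_pow, map_neg, map_ofNat]
      ring
    rw [h4, mul_smul, ← sub_eq_zero, ← smul_sub] at h2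
    have h5 : baseChange π _ = 0 := eps_smul_eq_zero h2
    rw [map_sub, baseChange_smul, baseChange_raise_pow, redl n (by omega), baseChange_lower, redw,
      hπa, hπι, hπι, hπι, sub_eq_zero] at h5
    exact h5.symm
  · have h2 := congrArg (braid (ι q) (ι a * (1 + E)) (ι d) (ι s)) hw
    rw [map_sub, map_smul, map_smul, bl m le_rfl, hxn, braid_raise_pow, bl n (by omega), ← hvm,
      ← hvn, hev, hev, hn, hεm, map_smul, ← hxn] at h2
    -- The eigenvalues -(1 + nε) and -(1 + mε) leave the multiple m - n = k + 1 of a^{k+1} v_m after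
    -- division by ε.
    have h3 : E • (baseChange ι w + braid (ι q) (ι a * (1 + E)) (ι d) (ι s) (baseChange ι w) -
        ((-(n : DualNumber 𝕜)) • xn + ((ι a * (1 + E)) ^ (k + 1) * m) • vm)) = 0 := by
      rw [smul_sub, smul_add, ← hw, ← h2]
      simp only [map_neg, map_one]
      module
    have h5 : baseChange π _ = 0 := eps_smul_eq_zero h3
    have h6 : π ((ι a * (1 + E)) ^ (k + 1) * m) = a ^ (k + 1) * m := by
      rw [map_mul, map_pow, hπa, map_natCast]
    rw [map_sub, map_add, map_add, baseChange_smul, baseChange_smul, baseChange_braid, redw, redxn,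
      redl m le_rfl, h6, map_neg, hπa, hπι, hπι, hπι, sub_eq_zero, map_natCast] at h5
    rw [h5, hm]
    push_cast
    module

end Dual

/-! ### The eigenvalue `-1` of the braiding -/

section Kernel

variable {𝕜 : Type*} [Field 𝕜] {q a d s : 𝕜}

open Classical in
/-- The elements of `𝕁` up to `m`. -/
def finJ (q r s : 𝕜) (m : ℕ) : Finset ℕ := (Finset.range (m + 1)).filter (MemJ q r s)

lemma mem_finJ {r : 𝕜} {m n : ℕ} : n ∈ finJ q r s m ↔ n ≤ m ∧ MemJ q r s n := by
  simp [finJ]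

lemma finJ_succ_of_not_mem {r : 𝕜} {m : ℕ} (h : ¬ MemJ q r s (m + 1)) :
    finJ q r s (m + 1) = finJ q r s m := by
  ext n
  rw [mem_finJ, mem_finJ]
  constructor
  · rintro ⟨h1, h2⟩
    refine ⟨?_, h2⟩
    rcases h1.eq_or_lt with rfl | h1
    · exact absurd h2 h
    · omega
  · rintro ⟨h1, h2⟩
    exact ⟨by omega, h2⟩

lemma finJ_succ_of_mem {r : 𝕜} {m : ℕ} (h : MemJ q r s (m + 1)) :
    finJ q r s (m + 1) = insert (m + 1) (finJ q r s m) := by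
  ext n
  rw [Finset.mem_insert, mem_finJ, mem_finJ]
  constructor
  · rintro ⟨h1, h2⟩
    rcases h1.eq_or_lt with rfl | h1
    · exact Or.inl rfl
    · exact Or.inr ⟨by omega, h2⟩
  · rintro (rfl | ⟨h1, h2⟩)
    · exact ⟨le_rfl, h⟩
    · exact ⟨by omega, h2⟩

lemma memJ_iff {r : 𝕜} {j : ℕ} : MemJ q r s j ↔
    q ^ (j * (j - 1) / 2) * (-r) ^ j * s = -1 ∧
      ∀ i : ℕ, i < j → MemJ q r s i → q ^ (j + i - 1) * r ^ 2 ≠ 1 := by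
  rw [MemJ]

/-- The vector of degree `m` in the module generated by the lowest weight vector of
degree `n`. -/
def raisedLowest (q a d : 𝕜) (m n : ℕ) : ℕ × ℕ →₀ 𝕜 := (raise q a ^ (m - n)) (lowest q a d n)

lemma raisedLowest_self (m : ℕ) : raisedLowest q a d m m = lowest q a d m := by
  simp [raisedLowest]

lemma raise_raisedLowest {m n : ℕ} (h : n ≤ m) :
    raise q a (raisedLowest q a d m n) = raisedLowest q a d (m + 1) n := by
  rw [raisedLowest, raisedLowest, Nat.sub_add_comm h, pow_succ', Module.End.mul_apply]

lemma raisedLowest_mem {m n : ℕ} (h : n ≤ m) : raisedLowest q a d m n ∈ homTens 𝕜 m := by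
  have := raise_pow_mem q a (lowest_mem q a d n) (m - n)
  rwa [Nat.add_sub_cancel' h] at this

lemma braid_raisedLowest {m n : ℕ} (h : n ≤ m)
    (hy : ∀ k, k < m → lowerCoeff q (a * d) (k + 1) ≠ 0) (hn : MemJ q (a * d) s n) :
    braid q a d s (raisedLowest q a d m n) = -raisedLowest q a d m n := by
  rw [raisedLowest, braid_raise_pow, braid_lowest s fun i hi => (hy i (by omega)).isUnit,
    (memJ_iff.mp hn).1]
  simp

lemma lower_raisedLowest {m n : ℕ} (h : n ≤ m)
    (hy : ∀ k, k < m + 1 → lowerCoeff q (a * d) (k + 1) ≠ 0) :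
    lower q a d (raisedLowest q a d (m + 1) n) =
      ((∑ i ∈ Finset.range (m - n + 1), q ^ i) * (1 - q ^ (m + n) * (a * d) ^ 2)) •
        raisedLowest q a d m n := by
  rw [raisedLowest, raisedLowest, Nat.sub_add_comm h, lower_raise_pow q a d (lowest_mem q a d n)
    (lower_lowest fun i hi => (hy i (by omega)).isUnit), lowerCoeff_succ, ← mul_assoc, ← pow_add]
  have : m - n + 2 * n = m + n := by omega
  rw [this]

lemma geomSum_ne_zero {r : 𝕜} {m : ℕ} (hy : ∀ k, k < m → lowerCoeff q r (k + 1) ≠ 0) {k : ℕ}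
    (hk : k < m) : ∑ i ∈ Finset.range (k + 1), q ^ i ≠ 0 := by
  have := hy k hk
  rw [lowerCoeff_succ] at this
  exact left_ne_zero_of_mul this

/-- Two resonances n < n' give q^{n'-n} = 1. As (n'-n)_q is nonzero, q = 1; then resonance does not
depend on the degree, and n would have excluded n' from 𝕁. -/
lemma resonance_unique {r : 𝕜} {m : ℕ} (hy : ∀ k, k < m → lowerCoeff q r (k + 1) ≠ 0)
    {n n' : ℕ} (hn : n ∈ finJ q r s m) (hn' : n' ∈ finJ q r s m)
    (h : q ^ (m + n) * r ^ 2 = 1) (h' : q ^ (m + n') * r ^ 2 = 1) : n = n' := by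
  wlog hlt : n < n' generalizing n n'
  · rcases (not_lt.mp hlt).eq_or_lt with he | hlt'
    · exact he.symm
    · exact (this hn' hn h' h hlt').symm
  exfalso
  rw [mem_finJ] at hn hn'
  obtain ⟨k, rfl⟩ : ∃ k, n' = n + (k + 1) := ⟨n' - n - 1, by omega⟩
  have h1 : q ^ (k + 1) = 1 := by
    calc q ^ (k + 1) = q ^ (k + 1) * (q ^ (m + n) * r ^ 2) := by rw [h, mul_one]
      _ = q ^ (m + (n + (k + 1))) * r ^ 2 := by ring
      _ = 1 := h'
  have h2 := mul_geom_sum q (k + 1)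
  rw [h1, sub_self, mul_eq_zero] at h2
  rcases h2 with h2 | h2
  · have hq : q = 1 := sub_eq_zero.mp h2
    have := (memJ_iff.mp hn'.2).2 n hlt hn.2
    rw [hq, one_pow, one_mul] at this h
    exact this h
  · exact geomSum_ne_zero hy (by omega) h2

/-- Induction on the degree. If the new degree belongs to 𝕁, lowering kills the new vector and
multiplies the others by nonzero factors, by the definition of 𝕁; otherwise injectivity of raising
suffices. -/
lemma linearIndependent_raisedLowest {m : ℕ}
    (hy : ∀ k, k < m → lowerCoeff q (a * d) (k + 1) ≠ 0) (c : ℕ → 𝕜)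
    (hc : ∑ n ∈ finJ q (a * d) s m, c n • raisedLowest q a d m n = 0) :
    ∀ n ∈ finJ q (a * d) s m, c n = 0 := by
  induction m generalizing c with
  | zero =>
    intro n hn
    obtain rfl : n = 0 := by have := (mem_finJ.mp hn).1; omega
    rw [Finset.sum_eq_single_of_mem 0 hn (fun b hb hb0 => absurd (mem_finJ.mp hb).1 (by omega)),
      raisedLowest_self] at hc
    simpa [lowest_apply_zero] using DFunLike.congr_fun hc (0, 0)
  | succ m ih =>
    have hy' : ∀ k, k < m → lowerCoeff q (a * d) (k + 1) ≠ 0 := fun k hk => hy k (by omega)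
    have hraise : ∀ c : ℕ → 𝕜, ∑ n ∈ finJ q (a * d) s m, c n • raisedLowest q a d (m + 1) n =
        raise q a (∑ n ∈ finJ q (a * d) s m, c n • raisedLowest q a d m n) := by
      intro c
      rw [map_sum]
      refine Finset.sum_congr rfl fun n hn => ?_
      rw [map_smul, raise_raisedLowest (mem_finJ.mp hn).1]
    by_cases h : MemJ q (a * d) s (m + 1)
    · have hnot : m + 1 ∉ finJ q (a * d) s m := fun h' => by
        have := (mem_finJ.mp h').1; omega
      rw [finJ_succ_of_mem h, Finset.sum_insert hnot, raisedLowest_self] at hc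
      have h2 := congrArg (lower q a d) hc
      rw [map_add, map_smul, lower_lowest fun i hi => (hy i hi).isUnit, smul_zero, zero_add,
        map_sum, map_zero] at h2
      have h3 := ih hy' (fun n => c n * ((∑ i ∈ Finset.range (m - n + 1), q ^ i) *
        (1 - q ^ (m + n) * (a * d) ^ 2))) (by
          rw [← h2]
          refine Finset.sum_congr rfl fun n hn => ?_
          rw [map_smul, lower_raisedLowest (mem_finJ.mp hn).1 hy, smul_smul])
      have h4 : ∀ n ∈ finJ q (a * d) s m, c n = 0 := by
        intro n hn
        obtain ⟨hn1, hn2⟩ := mem_finJ.mp hn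
        have h5 := (memJ_iff.mp h).2 n (by omega) hn2
        have h6 : m + 1 + n - 1 = m + n := by omega
        rw [h6] at h5
        exact (mul_eq_zero.mp (h3 n hn)).resolve_right
          (mul_ne_zero (geomSum_ne_zero hy (by omega)) (sub_ne_zero.mpr h5.symm))
      rw [Finset.sum_eq_zero fun n hn => by rw [h4 n hn, zero_smul], add_zero] at hc
      rw [finJ_succ_of_mem h]
      intro n hn
      rcases Finset.mem_insert.mp hn with rfl | hn
      · simpa [lowest_apply_zero] using DFunLike.congr_fun hc (0, m + 1)
      · exact h4 n hn
    · rw [finJ_succ_of_not_mem h, hraise] at hc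
      rw [finJ_succ_of_not_mem h]
      exact ih hy' c (raise_injective q a (by rw [hc, map_zero]))

/-- Lowering maps the -1 eigenspace to that of the previous degree. After correcting by preimages of
the lowered vector, a multiple of the lowest weight vector remains. -/
lemma exists_sum_raisedLowest [CharZero 𝕜] (ha : a ≠ 0) {m : ℕ}
    (hy : ∀ k, k < m → lowerCoeff q (a * d) (k + 1) ≠ 0) {t : ℕ × ℕ →₀ 𝕜} (ht : t ∈ homTens 𝕜 m)
    (hbt : braid q a d s t = -t) :
    ∃ c : ℕ → 𝕜, t = ∑ n ∈ finJ q (a * d) s m, c n • raisedLowest q a d m n := by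
  induction m generalizing t with
  | zero =>
    have h1 := eq_smul_lowest (q := q) (a := a) (d := d) (m := 0) (by simp) ht (by
      ext ⟨i, j⟩
      rw [lower_apply, mem_homTens.mp ht _ _ (by omega), mem_homTens.mp ht _ _ (by omega)]
      simp)
    by_cases h0 : t (0, 0) = 0
    · exact ⟨0, by rw [h1, h0]; simp⟩
    · have hs : MemJ q (a * d) s 0 := by
        rw [memJ_iff]
        refine ⟨?_, by simp⟩
        rw [h1, map_smul, braid_lowest s (by simp)] at hbt
        have := DFunLike.congr_fun hbt (0, 0)
        simp only [Finsupp.smul_apply, Finsupp.neg_apply, lowest_apply_zero, smul_eq_mul,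
          mul_one] at this
        refine mul_left_cancel₀ h0 ?_
        rw [this, mul_neg_one]
      refine ⟨fun _ => t (0, 0), ?_⟩
      have : finJ q (a * d) s 0 = {0} := by
        ext n
        rw [mem_finJ, Finset.mem_singleton]
        constructor
        · rintro ⟨h, -⟩; omega
        · rintro rfl; exact ⟨le_rfl, hs⟩
      rw [this, Finset.sum_singleton, raisedLowest_self]
      exact h1
  | succ m ih =>
    have hy' : ∀ k, k < m → lowerCoeff q (a * d) (k + 1) ≠ 0 := fun k hk => hy k (by omega)
    have hu := fun k hk => (hy k hk).isUnit
    obtain ⟨c, hc⟩ := ih hy' (lower_mem q a d ht) (by rw [← lower_braid, hbt, map_neg])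
    set κ : ℕ → 𝕜 := fun n => (∑ i ∈ Finset.range (m - n + 1), q ^ i) *
      (1 - q ^ (m + n) * (a * d) ^ 2) with hκ
    have hlow : ∀ n ∈ finJ q (a * d) s m, lower q a d (raisedLowest q a d (m + 1) n) =
        κ n • raisedLowest q a d m n := fun n hn => lower_raisedLowest (mem_finJ.mp hn).1 hy
    have hbr : ∀ b : ℕ → 𝕜, braid q a d s
        (∑ n ∈ finJ q (a * d) s m, b n • raisedLowest q a d (m + 1) n) =
        -∑ n ∈ finJ q (a * d) s m, b n • raisedLowest q a d (m + 1) n := by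
      intro b
      rw [map_sum, ← Finset.sum_neg_distrib]
      refine Finset.sum_congr rfl fun n hn => ?_
      obtain ⟨hn1, hn2⟩ := mem_finJ.mp hn
      rw [map_smul, braid_raisedLowest (by omega) hy hn2, smul_neg]
    have hmem : ∀ b : ℕ → 𝕜,
        ∑ n ∈ finJ q (a * d) s m, b n • raisedLowest q a d (m + 1) n ∈ homTens 𝕜 (m + 1) :=
      fun b => Submodule.sum_mem _ fun n hn => Submodule.smul_mem _ _
        (raisedLowest_mem (by have := (mem_finJ.mp hn).1; omega))
    by_cases hres : ∃ n ∈ finJ q (a * d) s m, q ^ (m + n) * (a * d) ^ 2 = 1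
    · obtain ⟨n₀, hn₀, hres⟩ := hres
      obtain ⟨hle, hJ⟩ := mem_finJ.mp hn₀
      have hnot : ¬ MemJ q (a * d) s (m + 1) := fun h => by
        refine (memJ_iff.mp h).2 n₀ (by omega) hJ ?_
        rw [← hres]
        congr 2; omega
      rw [finJ_succ_of_not_mem hnot]
      obtain ⟨k, rfl⟩ := Nat.exists_eq_add_of_le hle
      have h1 : q ^ (2 * n₀ + k) * (a * d) ^ 2 = 1 := by
        rw [← hres]; congr 2; omega
      rw [add_assoc] at ht hy
      obtain ⟨w, hw, hlw, hbw⟩ := exists_jordan (s := s) ha hy h1 (memJ_iff.mp hJ).1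
      have hg : (∑ i ∈ Finset.range (k + 1), q ^ i) ≠ 0 :=
        geomSum_ne_zero (m := n₀ + (k + 1)) hy (by omega)
      have hnz : ∀ n ∈ finJ q (a * d) s (n₀ + k), n ≠ n₀ → κ n ≠ 0 := by
        intro n hn hne
        refine mul_ne_zero (geomSum_ne_zero (m := n₀ + (k + 1)) hy (by omega))
          (sub_ne_zero.mpr fun h => hne ?_)
        exact resonance_unique hy' hn hn₀ h.symm hres
      -- The n₀ component of the lowered vector has no preimage among the raised vectors, as its
      -- factor κ vanishes; the Jordan vector w serves instead.
      set b : ℕ → 𝕜 := fun n => if n = n₀ then 0 else c n / κ n with hb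
      set e : 𝕜 := c n₀ / (-2 * ∑ i ∈ Finset.range (k + 1), q ^ i) with he
      set t' := t - ∑ n ∈ finJ q (a * d) s (n₀ + k), b n • raisedLowest q a d (n₀ + k + 1) n -
        e • w with ht'
      have ht'mem : t' ∈ homTens 𝕜 (n₀ + (k + 1)) :=
        Submodule.sub_mem _ (Submodule.sub_mem _ ht (hmem b)) (Submodule.smul_mem _ _ hw)
      have ht'low : lower q a d t' = 0 := by
        rw [ht', map_sub, map_sub, map_smul, hc, hlw, map_sum, ← Finset.sum_sub_distrib,
          Finset.sum_eq_single_of_mem n₀ hn₀]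
        · rw [map_smul, smul_smul, he, div_mul_cancel₀ _ (mul_ne_zero (by simp) hg)]
          simp [hb, raisedLowest]
        · intro n hn hne
          rw [map_smul, hlow n hn, smul_smul]
          simp only [hb, hne, if_false]
          rw [div_mul_cancel₀ _ (hnz n hn hne), sub_self]
      have hrl := raise_pow_lowest hy h1
      have hlowest : lowest q a d (n₀ + (k + 1)) =
          (a ^ (k + 1))⁻¹ • raisedLowest q a d (n₀ + k + 1) n₀ := by
        have : n₀ + k + 1 - n₀ = k + 1 := by omega
        rw [raisedLowest, this, hrl, smul_smul, inv_mul_cancel₀ (pow_ne_zero _ ha), one_smul]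
      have h2 := eq_smul_lowest (isUnit_lowerCoeff hy) ht'mem ht'low
      have hbt' : braid q a d s t' = -t' := by
        rw [h2, hlowest, map_smul, map_smul, braid_raisedLowest (m := n₀ + k + 1) (by omega) hy hJ]
        simp
      -- All other terms have eigenvalue -1, so e • w does too. As w is not an eigenvector, e = 0;
      -- characteristic zero enters through k + 1 ≠ 0.
      have h3 : e • (w + braid q a d s w) = 0 := by
        have h4 : e • w = t - ∑ n ∈ finJ q (a * d) s (n₀ + k),
            b n • raisedLowest q a d (n₀ + k + 1) n - t' := by rw [ht']; abel
        rw [smul_add, ← map_smul, h4, map_sub, map_sub, hbt, hbr, hbt']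
        abel
      rw [hbw, smul_smul] at h3
      have h4 : e = 0 := by
        have := DFunLike.congr_fun h3 (0, n₀ + (k + 1))
        simp only [Finsupp.smul_apply, lowest_apply_zero, smul_eq_mul, mul_one,
          Finsupp.zero_apply] at this
        exact (mul_eq_zero.mp this).resolve_right
          (mul_ne_zero (Nat.cast_ne_zero.mpr (Nat.succ_ne_zero k)) (pow_ne_zero _ ha))
      refine ⟨fun n => b n + if n = n₀ then t' (0, n₀ + (k + 1)) * (a ^ (k + 1))⁻¹ else 0, ?_⟩
      have h5 : t = t' + ∑ n ∈ finJ q (a * d) s (n₀ + k),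
          b n • raisedLowest q a d (n₀ + k + 1) n := by
        rw [ht', h4, zero_smul]; abel
      conv_lhs => rw [h5, h2, hlowest, smul_smul]
      simp only [add_smul, Finset.sum_add_distrib, ite_smul, zero_smul]
      rw [Finset.sum_ite_eq' _ _ _, if_pos hn₀, add_comm]
    · push Not at hres
      have hnz : ∀ n ∈ finJ q (a * d) s m, κ n ≠ 0 := fun n hn =>
        mul_ne_zero (geomSum_ne_zero hy (by omega)) (sub_ne_zero.mpr (hres n hn).symm)
      set t' := t - ∑ n ∈ finJ q (a * d) s m, (c n / κ n) • raisedLowest q a d (m + 1) n with ht'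
      have ht'mem : t' ∈ homTens 𝕜 (m + 1) :=
        Submodule.sub_mem _ ht (hmem fun n => c n / κ n)
      have ht'low : lower q a d t' = 0 := by
        rw [ht', map_sub, hc, map_sum, sub_eq_zero]
        refine Finset.sum_congr rfl fun n hn => ?_
        rw [map_smul, hlow n hn, smul_smul, div_mul_cancel₀ _ (hnz n hn)]
      have h2 := eq_smul_lowest hu ht'mem ht'low
      have hbt' : braid q a d s t' = -t' := by
        rw [ht', map_sub, hbt, hbr fun n => c n / κ n]
        abel
      have h5 : t = t' + ∑ n ∈ finJ q (a * d) s m,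
          (c n / κ n) • raisedLowest q a d (m + 1) n := by
        rw [ht']; abel
      by_cases h0 : t' (0, m + 1) = 0
      · have ht0 : t' = 0 := by rw [h2, h0, zero_smul]
        rw [ht0, zero_add] at h5
        refine ⟨fun n => if n = m + 1 then 0 else c n / κ n, ?_⟩
        have hsub : finJ q (a * d) s m ⊆ finJ q (a * d) s (m + 1) := fun n hn => by
          rw [mem_finJ] at hn ⊢
          exact ⟨by omega, hn.2⟩
        conv_lhs => rw [h5]
        rw [← Finset.sum_subset hsub]
        · refine Finset.sum_congr rfl fun n hn => ?_
          have := (mem_finJ.mp hn).1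
          dsimp only
          rw [if_neg (by omega)]
        · intro n hn hn'
          have : n = m + 1 := by
            rw [mem_finJ] at hn hn'
            by_contra hne
            exact hn' ⟨by omega, hn.2⟩
          simp [this]
      -- A nonzero remainder is a lowest weight vector with eigenvalue -1, and the absence of
      -- resonances is the second condition in the definition of 𝕁.
      · have hJ : MemJ q (a * d) s (m + 1) := by
          rw [memJ_iff]
          constructor
          · rw [h2, map_smul, braid_lowest s hu] at hbt'
            have := DFunLike.congr_fun hbt' (0, m + 1)
            simp only [Finsupp.smul_apply, Finsupp.neg_apply, lowest_apply_zero, smul_eq_mul,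
              mul_one] at this
            refine mul_left_cancel₀ h0 ?_
            rw [this, mul_neg_one]
          · intro i hi hiJ
            have := hres i (mem_finJ.mpr ⟨by omega, hiJ⟩)
            have h6 : m + 1 + i - 1 = m + i := by omega
            rwa [h6]
        refine ⟨fun n => if n = m + 1 then t' (0, m + 1) else c n / κ n, ?_⟩
        have hnot : m + 1 ∉ finJ q (a * d) s m := fun h' => by
          have := (mem_finJ.mp h').1; omega
        rw [finJ_succ_of_mem hJ, Finset.sum_insert hnot]
        dsimp only
        rw [if_pos rfl, raisedLowest_self, ← h2]
        conv_lhs => rw [h5]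
        congr 1
        refine Finset.sum_congr rfl fun n hn => ?_
        have := (mem_finJ.mp hn).1
        rw [if_neg (by omega)]

/-- The tensors of degree `m` on which the braiding acts by `-1`. -/
def relTens (q a d s : 𝕜) (m : ℕ) : Submodule 𝕜 (ℕ × ℕ →₀ 𝕜) :=
  homTens 𝕜 m ⊓ LinearMap.ker (LinearMap.id + braid q a d s)

lemma mem_relTens {m : ℕ} {t : ℕ × ℕ →₀ 𝕜} :
    t ∈ relTens q a d s m ↔ t ∈ homTens 𝕜 m ∧ t + braid q a d s t = 0 := by
  simp [relTens]

theorem finrank_relTens [CharZero 𝕜] (ha : a ≠ 0) {m : ℕ}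
    (hy : ∀ k, k < m → lowerCoeff q (a * d) (k + 1) ≠ 0) :
    Module.finrank 𝕜 (relTens q a d s m) = (finJ q (a * d) s m).card := by
  let f : finJ q (a * d) s m → ℕ × ℕ →₀ 𝕜 := fun n => raisedLowest q a d m n
  have hli : LinearIndependent 𝕜 f := by
    rw [Fintype.linearIndependent_iff]
    intro g hg i
    have := linearIndependent_raisedLowest (s := s) hy
      (fun n => if h : n ∈ finJ q (a * d) s m then g ⟨n, h⟩ else 0) (by
        rw [← hg, ← Finset.sum_coe_sort (finJ q (a * d) s m)]
        exact Finset.sum_congr rfl fun n _ => by simp [f]) i i.2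
    simpa using this
  have hspan : Submodule.span 𝕜 (Set.range f) = relTens q a d s m := by
    apply le_antisymm
    · rw [Submodule.span_le]
      rintro _ ⟨⟨n, hn⟩, rfl⟩
      obtain ⟨h1, h2⟩ := mem_finJ.mp hn
      exact mem_relTens.mpr ⟨raisedLowest_mem h1, by
        rw [braid_raisedLowest h1 hy h2, add_neg_cancel]⟩
    · intro t ht
      obtain ⟨h1, h2⟩ := mem_relTens.mp ht
      obtain ⟨c, rfl⟩ := exists_sum_raisedLowest ha hy h1 (eq_neg_of_add_eq_zero_right h2)
      exact Submodule.sum_mem _ fun n hn => Submodule.smul_mem _ _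
        (Submodule.subset_span ⟨⟨n, hn⟩, rfl⟩)
  rw [← hspan, finrank_span_eq_card hli, Fintype.card_coe]

end Kernel

/-! ### Lyndon words with at most two letters `1` -/

section Words

/-- The word `0^k 1`. -/
def wordOne (k : ℕ) : List (Fin 2) := List.replicate k 0 ++ [1]

/-- The word `0^a 1 0^b 1`. -/
def wordTwo (a b : ℕ) : List (Fin 2) := List.replicate a 0 ++ 1 :: wordOne b

lemma replicate_append_lt_iff (i j : ℕ) (x y : List (Fin 2)) :
    List.replicate i 0 ++ 1 :: x < List.replicate j 0 ++ 1 :: y ↔ j < i ∨ (j = i ∧ x < y) := by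
  induction i generalizing j with
  | zero => cases j <;> simp [List.replicate_succ, List.cons_lt_cons_iff]
  | succ i ih => cases j <;> simp [List.replicate_succ, List.cons_lt_cons_iff, ih]

lemma replicate_lt (t i : ℕ) (x : List (Fin 2)) :
    List.replicate t 0 < List.replicate i 0 ++ 1 :: x := by
  induction t generalizing i with
  | zero => cases i <;> simp [List.replicate_succ]
  | succ t ih => cases i <;> simp [List.replicate_succ, List.cons_lt_cons_iff, ih]

lemma replicate_append_inj {i j : ℕ} {x y : List (Fin 2)}
    (h : List.replicate i 0 ++ 1 :: x = List.replicate j 0 ++ 1 :: y) : i = j ∧ x = y := by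
  induction i generalizing j with
  | zero => cases j <;> simp_all [List.replicate_succ]
  | succ i ih =>
    cases j with
    | zero => simp [List.replicate_succ] at h
    | succ j =>
      simp only [List.replicate_succ, List.cons_append, List.cons.injEq, true_and] at h
      have := ih h
      exact ⟨by omega, this.2⟩

lemma wordTwo_inj {a b a' b' : ℕ} (h : wordTwo a b = wordTwo a' b') : a = a' ∧ b = b' := by
  obtain ⟨h1, h2⟩ := replicate_append_inj h
  exact ⟨h1, (replicate_append_inj h2).1⟩

lemma wordTwo_lt_wordOne_iff (a b j : ℕ) : wordTwo a b < wordOne j ↔ j < a := by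
  rw [wordTwo, wordOne.eq_1 j, replicate_append_lt_iff]
  simp

lemma wordTwo_lt_wordTwo_iff (a b a' b' : ℕ) :
    wordTwo a b < wordTwo a' b' ↔ a' < a ∨ (a' = a ∧ b' < b) := by
  rw [wordTwo, wordTwo, replicate_append_lt_iff, wordOne, wordOne, replicate_append_lt_iff]
  simp

lemma wordOne_lt_wordOne_iff (i j : ℕ) : wordOne i < wordOne j ↔ j < i := by
  rw [wordOne, wordOne, replicate_append_lt_iff]
  simp

lemma eq_replicate_of_count {x : List (Fin 2)} (h : x.count 1 = 0) :
    x = List.replicate x.length 0 := by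
  rw [List.eq_replicate_iff]
  refine ⟨rfl, fun b hb => ?_⟩
  rw [List.count_eq_zero] at h
  have : b ≠ 1 := fun h' => h (h' ▸ hb)
  omega

lemma exists_eq_of_count {x : List (Fin 2)} {n : ℕ} (h : x.count 1 = n + 1) :
    ∃ i y, x = List.replicate i 0 ++ 1 :: y ∧ y.count 1 = n := by
  induction x with
  | nil => simp at h
  | cons c x ih =>
    rcases Fin.exists_fin_two.mp ⟨c, rfl⟩ with hc | hc
    · subst hc
      obtain ⟨i, y, rfl, hy⟩ := ih (by simpa using h)
      exact ⟨i + 1, y, by simp [List.replicate_succ], hy⟩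
    · subst hc
      exact ⟨0, x, by simp, by simpa using h⟩

lemma append_eq_cases {i : ℕ} {x w v : List (Fin 2)}
    (h : List.replicate i 0 ++ 1 :: x = w ++ v) :
    (∃ p, p ≤ i ∧ w = List.replicate p 0 ∧ v = List.replicate (i - p) 0 ++ 1 :: x) ∨
      ∃ x₁, w = List.replicate i 0 ++ 1 :: x₁ ∧ x = x₁ ++ v := by
  induction i generalizing w with
  | zero =>
    cases w with
    | nil => exact Or.inl ⟨0, le_rfl, rfl, by simpa using h.symm⟩
    | cons c w =>
      simp only [List.replicate_zero, List.nil_append, List.cons_append, List.cons.injEq] at h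
      exact Or.inr ⟨w, by simp [← h.1], h.2⟩
  | succ i ih =>
    cases w with
    | nil => exact Or.inl ⟨0, by omega, rfl, by simpa using h.symm⟩
    | cons c w =>
      simp only [List.replicate_succ, List.cons_append, List.cons.injEq] at h
      rcases ih h.2 with ⟨p, hp, h1, h2⟩ | ⟨x₁, h1, h2⟩
      · exact Or.inl ⟨p + 1, by omega, by rw [← h.1, h1]; rfl, by rw [h2]; congr 2; omega⟩
      · exact Or.inr ⟨x₁, by rw [← h.1, h1]; rfl, h2⟩

lemma isLyndon_singleton (i : Fin 2) : IsLyndon [i] := by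
  refine ⟨by simp, fun w v hw hv h => ?_⟩
  have := congrArg List.length h
  have h1 := List.length_pos_iff.mpr hw
  have h2 := List.length_pos_iff.mpr hv
  simp at this
  omega

lemma isLyndon_wordOne (k : ℕ) : IsLyndon (wordOne k) := by
  refine ⟨by simp [wordOne], fun w v hw hv h => ?_⟩
  rw [wordOne] at h ⊢
  rcases append_eq_cases h with ⟨p, hp, rfl, rfl⟩ | ⟨x, rfl, hx⟩
  · have hp0 : p ≠ 0 := by rintro rfl; simp at hw
    rw [List.append_assoc, List.cons_append, replicate_append_lt_iff]
    left; omega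
  · simp at hx
    exact absurd hx.2 hv

lemma isLyndon_wordTwo {a b : ℕ} (h : b < a) : IsLyndon (wordTwo a b) := by
  refine ⟨by simp [wordTwo], fun w v hw hv h => ?_⟩
  rw [wordTwo] at h ⊢
  rcases append_eq_cases h with ⟨p, hp, rfl, rfl⟩ | ⟨x, rfl, hx⟩
  · have hp0 : p ≠ 0 := by rintro rfl; simp at hw
    rw [List.append_assoc, List.cons_append, replicate_append_lt_iff]
    left; omega
  · rcases append_eq_cases hx with ⟨p, hp, rfl, rfl⟩ | ⟨y, rfl, hy⟩
    · rw [List.append_assoc, List.cons_append, replicate_append_lt_iff]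
      left; omega
    · simp at hy
      exact absurd hy.2 hv

/-- Rotating trailing zeros to the front lengthens the initial run of zeros and makes the word
smaller. -/
lemma IsLyndon.eq_nil_of_append_replicate {i k : ℕ} {x : List (Fin 2)}
    (h : IsLyndon (List.replicate i 0 ++ 1 :: (x ++ List.replicate k 0))) : k = 0 := by
  by_contra hk
  have := h.2 (List.replicate i 0 ++ 1 :: x) (List.replicate k 0) (by simp)
    (by simpa using hk) (by simp)
  rw [← List.append_assoc, ← List.replicate_add, replicate_append_lt_iff] at this
  omega

lemma IsLyndon.eq_wordOne {u : List (Fin 2)} (h : IsLyndon u) (hc : u.count 1 = 1) :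
    ∃ k, u = wordOne k := by
  obtain ⟨i, y, rfl, hy⟩ := exists_eq_of_count hc
  rw [eq_replicate_of_count hy] at h
  have := IsLyndon.eq_nil_of_append_replicate (x := []) h
  rw [List.length_eq_zero_iff] at this
  exact ⟨i, by rw [this, wordOne]⟩

lemma IsLyndon.eq_wordTwo {u : List (Fin 2)} (h : IsLyndon u) (hc : u.count 1 = 2) :
    ∃ a b, b < a ∧ u = wordTwo a b := by
  obtain ⟨i, y, rfl, hy⟩ := exists_eq_of_count hc
  obtain ⟨j, z, rfl, hz⟩ := exists_eq_of_count hy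
  rw [eq_replicate_of_count hz] at h
  have e : List.replicate j (0 : Fin 2) ++ 1 :: List.replicate z.length 0 =
      wordOne j ++ List.replicate z.length 0 := by simp [wordOne]
  rw [e] at h
  have h0 := h.eq_nil_of_append_replicate
  rw [h0, List.replicate_zero, List.append_nil] at h
  rw [List.length_eq_zero_iff] at h0
  subst h0
  refine ⟨i, j, ?_, rfl⟩
  have := h.2 (wordOne i) (wordOne j) (by simp [wordOne]) (by simp [wordOne]) (by simp [wordOne])
  rw [wordOne, wordOne, List.append_assoc, List.singleton_append, replicate_append_lt_iff,
    replicate_append_lt_iff] at this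
  rcases this with h1 | ⟨h1, h2 | h2⟩
  · exact h1
  · omega
  · simp [h1] at h2

lemma IsLyndon.eq_one_of_replicate {i : ℕ} (h : IsLyndon (List.replicate i (0 : Fin 2))) :
    i = 1 := by
  rcases i with _ | _ | i
  · exact absurd rfl h.1
  · rfl
  · have := h.2 [0] (List.replicate (i + 1) 0) (by simp) (by simp) rfl
    rw [← List.replicate_succ'] at this
    exact absurd this (List.lt_irrefl _)

lemma not_isLyndon_wordTwo_self (b : ℕ) : ¬ IsLyndon (wordTwo b b) := fun h => by
  obtain ⟨a, c, hlt, he⟩ := h.eq_wordTwo (by simp [wordTwo, wordOne, List.count_replicate])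
  obtain ⟨h1, h2⟩ := wordTwo_inj he
  omega

lemma shirshovIndex_eq_one {u : List (Fin 2)} (hu : u ≠ []) (h : IsLyndon u) :
    shirshovIndex (0 :: u) = 1 := by
  have hpos := List.length_pos_iff.mpr hu
  have hmem : 1 ∈ {i : ℕ | 0 < i ∧ i < (0 :: u).length ∧ IsLyndon ((0 :: u).take i) ∧
      IsLyndon ((0 :: u).drop i)} :=
    ⟨one_pos, by simpa using hpos, by simpa using isLyndon_singleton 0, by simpa using h⟩
  apply le_antisymm (Nat.sInf_le hmem)
  exact (Nat.sInf_mem ⟨1, hmem⟩).1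

lemma shirshovIndex_wordTwo (b : ℕ) : shirshovIndex (wordTwo (b + 1) b) = b + 2 := by
  have e : wordTwo (b + 1) b = wordOne (b + 1) ++ wordOne b := by simp [wordTwo, wordOne]
  have hl : (wordOne (b + 1)).length = b + 2 := by simp [wordOne]
  have hmem : b + 2 ∈ {i : ℕ | 0 < i ∧ i < (wordTwo (b + 1) b).length ∧
      IsLyndon ((wordTwo (b + 1) b).take i) ∧ IsLyndon ((wordTwo (b + 1) b).drop i)} := by
    refine ⟨by omega, by simp [wordTwo, wordOne], ?_, ?_⟩
    · rw [e, ← hl, List.take_left]; exact isLyndon_wordOne _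
    · rw [e, ← hl, List.drop_left]; exact isLyndon_wordOne _
  refine le_antisymm (Nat.sInf_le hmem)
    (?_ : b + 2 ≤ shirshovIndex (wordTwo (b + 1) b))
  obtain ⟨h1, h2, h3, h4⟩ := Nat.sInf_mem ⟨b + 2, hmem⟩
  change 0 < shirshovIndex _ at h1
  change IsLyndon (List.take (shirshovIndex _) _) at h3
  change IsLyndon (List.drop (shirshovIndex _) _) at h4
  by_contra! hlt
  generalize shirshovIndex (wordTwo (b + 1) b) = i at *
  have ht : (wordTwo (b + 1) b).take i = List.replicate i 0 := by
    rw [wordTwo, List.take_append_of_le_length (by simp; omega), List.take_replicate]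
    congr 1; omega
  rw [ht] at h3
  -- A shorter cut lies in the initial zeros, so it must have length one. What remains is the square
  -- of 0^b 1, which is not Lyndon.
  rw [h3.eq_one_of_replicate] at h4
  exact not_isLyndon_wordTwo_self b h4

variable {𝕜 : Type*} [Field 𝕜] (Q : Fin 2 → Fin 2 → 𝕜ˣ)

lemma superLetter_of_shirshovIndex {v w : List (Fin 2)} (hv : v ≠ []) (hw : w ≠ [])
    (h : shirshovIndex (v ++ w) = v.length) :
    superLetter Q (v ++ w) = superLetter Q v * superLetter Q w -
      (chi Q (degree v) (degree w) : 𝕜) • (superLetter Q w * superLetter Q v) := by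
  have h1 := List.length_pos_iff.mpr hv
  have h2 := List.length_pos_iff.mpr hw
  rw [superLetter, dif_pos (by rw [h]; simp; omega), h, List.take_left, List.drop_left]

lemma superLetter_singleton (i : Fin 2) : superLetter Q [i] = gen Q i := by
  rw [superLetter, dif_neg (by simp; omega)]

lemma degree_wordOne (k : ℕ) : degree (wordOne k) = ![k, 1] := by
  ext i
  fin_cases i <;> simp [degree, wordOne, List.count_replicate]

lemma degree_wordTwo (a b : ℕ) : degree (wordTwo a b) = ![a + b, 2] := by
  ext i
  fin_cases i <;> simp [degree, wordTwo, wordOne, List.count_replicate]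

lemma degree_zero_singleton : degree [(0 : Fin 2)] = ![1, 0] := by
  ext i
  fin_cases i <;> simp [degree]

lemma chi_cons (a b c e : ℕ) : (chi Q ![a, b] ![c, e] : 𝕜) =
    (Q 0 0 : 𝕜) ^ (a * c) * (Q 0 1 : 𝕜) ^ (a * e) *
      ((Q 1 0 : 𝕜) ^ (b * c) * (Q 1 1 : 𝕜) ^ (b * e)) := by
  simp [chi, Fin.prod_univ_two]

/-- The element `[0^k 1]`, that is `(ad x_1)^k (x_2)`. -/
def adGen (k : ℕ) : NicholsAlgebra Q := superLetter Q (wordOne k)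

lemma adGen_zero : adGen Q 0 = gen Q 1 := superLetter_singleton Q 1

lemma adGen_succ (k : ℕ) : adGen Q (k + 1) = gen Q 0 * adGen Q k -
    ((Q 0 0 : 𝕜) ^ k * (Q 0 1 : 𝕜)) • (adGen Q k * gen Q 0) := by
  have h := superLetter_of_shirshovIndex Q (v := [0]) (w := wordOne k) (by simp)
    (by simp [wordOne]) (shirshovIndex_eq_one (by simp [wordOne]) (isLyndon_wordOne k))
  rw [superLetter_singleton, degree_zero_singleton, degree_wordOne, chi_cons] at h
  simpa [adGen, wordOne, List.replicate_succ] using h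

lemma superLetter_wordTwo_succ (b : ℕ) : superLetter Q (wordTwo (b + 1) b) =
    adGen Q (b + 1) * adGen Q b - ((Q 0 0 : 𝕜) ^ ((b + 1) * b) * (Q 0 1 : 𝕜) ^ (b + 1) *
      ((Q 1 0 : 𝕜) ^ b * (Q 1 1 : 𝕜))) • (adGen Q b * adGen Q (b + 1)) := by
  have e : wordTwo (b + 1) b = wordOne (b + 1) ++ wordOne b := by simp [wordTwo, wordOne]
  have h := superLetter_of_shirshovIndex Q (v := wordOne (b + 1)) (w := wordOne b)
    (by simp [wordOne]) (by simp [wordOne])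
    (by rw [← e, shirshovIndex_wordTwo]; simp [wordOne])
  rw [degree_wordOne, degree_wordOne, chi_cons] at h
  rw [e, h]
  simp [adGen]

lemma superLetter_wordTwo_cons {a b : ℕ} (h : b < a) : superLetter Q (wordTwo (a + 1) b) =
    gen Q 0 * superLetter Q (wordTwo a b) - ((Q 0 0 : 𝕜) ^ (a + b) * (Q 0 1 : 𝕜) ^ 2) •
      (superLetter Q (wordTwo a b) * gen Q 0) := by
  have h := superLetter_of_shirshovIndex Q (v := [0]) (w := wordTwo a b) (by simp)
    (by simp [wordTwo]) (shirshovIndex_eq_one (by simp [wordTwo]) (isLyndon_wordTwo h))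
  rw [superLetter_singleton, degree_zero_singleton, degree_wordTwo, chi_cons] at h
  simpa [wordTwo, List.replicate_succ] using h

end Words

/-! ### Products of two elements `(ad x_1)^i (x_2)` -/

section Products

variable {𝕜 : Type*} [Field 𝕜] (Q : Fin 2 → Fin 2 → 𝕜ˣ)

/-- The multiplication `u_i ⊗ u_j ↦ u_i u_j`, where `u_i = (ad x_1)^i (x_2)`. -/
def mulTens : (ℕ × ℕ →₀ 𝕜) →ₗ[𝕜] NicholsAlgebra Q :=
  Finsupp.linearCombination 𝕜 fun p => adGen Q p.1 * adGen Q p.2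

/-- The map `u_i ⊗ u_j ↦ u_i ∂_2(u_j)`. -/
def derivTens : (ℕ × ℕ →₀ 𝕜) →ₗ[𝕜] NicholsAlgebra Q :=
  Finsupp.linearCombination 𝕜 fun p =>
    bCoeff (Q 0 0 : 𝕜) (Q 0 1 * Q 1 0) p.2 • (adGen Q p.1 * gen Q 0 ^ p.2)

@[simp] lemma mulTens_tens (i j : ℕ) : mulTens Q (tens i j) = adGen Q i * adGen Q j := by
  simp [mulTens, tens]

@[simp] lemma derivTens_tens (i j : ℕ) : derivTens Q (tens i j) =
    bCoeff (Q 0 0 : 𝕜) (Q 0 1 * Q 1 0) j • (adGen Q i * gen Q 0 ^ j) := by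
  simp [derivTens, tens]

lemma bCoeff_succ (q r : 𝕜) (m : ℕ) : bCoeff q r (m + 1) = bCoeff q r m * (1 - q ^ m * r) := by
  rw [bCoeff, Finset.prod_range_succ, ← bCoeff]

lemma gen_mul_adGen (k : ℕ) : gen Q 0 * adGen Q k = adGen Q (k + 1) +
    ((Q 0 0 : 𝕜) ^ k * (Q 0 1 : 𝕜)) • (adGen Q k * gen Q 0) := by
  rw [adGen_succ]; abel

lemma scale_adGen (t : Fin 2 → 𝕜) (k : ℕ) :
    scale Q t (adGen Q k) = (t 0 ^ k * t 1) • adGen Q k := by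
  induction k with
  | zero => simp [adGen_zero]
  | succ k ih =>
    simp only [adGen_succ, map_sub, map_mul, map_smul, ih, scale_gen, smul_mul_assoc,
      mul_smul_comm, smul_sub, smul_smul]
    congr 2 <;> ring

@[simp] lemma counit_adGen (k : ℕ) : counit Q (adGen Q k) = 0 := by
  cases k with
  | zero => simp [adGen_zero]
  | succ k => simp [adGen_succ]

lemma skewDeriv_zero_adGen (k : ℕ) : skewDeriv Q 0 (adGen Q k) = 0 := by
  induction k with
  | zero => simp [adGen_zero]
  | succ k ih => simp [adGen_succ, skewDeriv_mul, ih, scale_adGen]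

lemma skewDeriv_one_adGen (k : ℕ) : skewDeriv Q 1 (adGen Q k) =
    bCoeff (Q 0 0 : 𝕜) (Q 0 1 * Q 1 0) k • gen Q 0 ^ k := by
  induction k with
  | zero => simp [adGen_zero, bCoeff]
  | succ k ih =>
    have h1 : gen Q 0 * gen Q 0 ^ k = gen Q 0 ^ (k + 1) := (pow_succ' _ _).symm
    have h2 : gen Q 0 ^ k * gen Q 0 = gen Q 0 ^ (k + 1) := (pow_succ _ _).symm
    simp only [adGen_succ, map_sub, map_smul, skewDeriv_mul, ih, skewDeriv_gen, scale_gen,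
      bCoeff_succ, smul_mul_assoc, mul_smul_comm, h1, h2, smul_smul]
    simp
    module

lemma skewDeriv_zero_gen_pow (k : ℕ) : skewDeriv Q 0 (gen Q 0 ^ (k + 1)) =
    (∑ i ∈ Finset.range (k + 1), (Q 0 0 : 𝕜) ^ i) • gen Q 0 ^ k := by
  induction k with
  | zero => simp
  | succ k ih =>
    rw [pow_succ', skewDeriv_mul, ih, Finset.sum_range_succ _ (k + 1), add_smul]
    simp only [mul_smul_comm, ← pow_succ', skewDeriv_gen, map_pow, scale_gen, smul_pow, if_true,
      one_mul]

/-- Raising is the braided adjoint action of x_1 on products, by its twisted Leibniz rule. -/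
lemma mulTens_raise {m : ℕ} {t : ℕ × ℕ →₀ 𝕜} (ht : t ∈ homTens 𝕜 m) :
    mulTens Q (raise (Q 0 0 : 𝕜) (Q 0 1) t) = gen Q 0 * mulTens Q t -
      ((Q 0 0 : 𝕜) ^ m * (Q 0 1 : 𝕜) ^ 2) • (mulTens Q t * gen Q 0) := by
  refine map_supported_eq (mulTens Q ∘ₗ raise (Q 0 0 : 𝕜) (Q 0 1))
    (LinearMap.mulLeft 𝕜 (gen Q 0) ∘ₗ mulTens Q - ((Q 0 0 : 𝕜) ^ m * (Q 0 1 : 𝕜) ^ 2) •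
      (LinearMap.mulRight 𝕜 (gen Q 0) ∘ₗ mulTens Q)) (fun i j hij => ?_) ht
  have : i + j = m := hij
  subst this
  have h := gen_mul_adGen Q j
  simp only [LinearMap.comp_apply, raise_tens, map_add, map_smul, mulTens_tens,
    LinearMap.sub_apply, LinearMap.smul_apply, LinearMap.mulLeft_apply, LinearMap.mulRight_apply]
  rw [← mul_assoc, gen_mul_adGen, add_mul, smul_mul_assoc, mul_assoc (adGen Q i), h, mul_add,
    mul_smul_comm, mul_assoc]
  module

lemma derivTens_raise {m : ℕ} {t : ℕ × ℕ →₀ 𝕜} (ht : t ∈ homTens 𝕜 m) :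
    derivTens Q (raise (Q 0 0 : 𝕜) (Q 0 1) t) = gen Q 0 * derivTens Q t -
      ((Q 0 0 : 𝕜) ^ m * (Q 0 1 : 𝕜) * (Q 0 1 * Q 1 0)) • (derivTens Q t * gen Q 0) := by
  refine map_supported_eq (derivTens Q ∘ₗ raise (Q 0 0 : 𝕜) (Q 0 1))
    (LinearMap.mulLeft 𝕜 (gen Q 0) ∘ₗ derivTens Q -
      ((Q 0 0 : 𝕜) ^ m * (Q 0 1 : 𝕜) * (Q 0 1 * Q 1 0)) •
      (LinearMap.mulRight 𝕜 (gen Q 0) ∘ₗ derivTens Q)) (fun i j hij => ?_) ht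
  have : i + j = m := hij
  subst this
  simp only [LinearMap.comp_apply, raise_tens, map_add, map_smul, derivTens_tens,
    LinearMap.sub_apply, LinearMap.smul_apply, LinearMap.mulLeft_apply, LinearMap.mulRight_apply]
  rw [← mul_assoc (gen Q 0), gen_mul_adGen, add_mul, smul_mul_assoc,
    mul_assoc (adGen Q i) (gen Q 0), ← pow_succ', mul_assoc (adGen Q i),
    ← pow_succ, bCoeff_succ]
  module

lemma derivTens_braidTens (i j : ℕ) :
    derivTens Q (braidTens (Q 0 0 : 𝕜) (Q 0 1) (Q 1 0) (Q 1 1) i j) =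
      ((Q 1 0 : 𝕜) ^ j * Q 1 1 * bCoeff (Q 0 0 : 𝕜) (Q 0 1 * Q 1 0) i) •
        (gen Q 0 ^ i * adGen Q j) := by
  induction i generalizing j with
  | zero => simp [braidTens, bCoeff]
  | succ i ih =>
    rw [braidTens, map_sub, map_smul, derivTens_raise Q (braidTens_mem _ _ _ _ i j), ih, ih,
      adGen_succ, bCoeff_succ]
    simp only [mul_smul_comm, mul_sub, ← mul_assoc, smul_mul_assoc]
    rw [← pow_succ', ← pow_succ]
    module

/-- The Leibniz rule gives a term from each factor. The derivative of the right factor is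
`derivTens`; that of the left factor is `derivTens` after braiding, by `derivTens_braidTens`. -/
lemma skewDeriv_one_mulTens (t : ℕ × ℕ →₀ 𝕜) : skewDeriv Q 1 (mulTens Q t) =
    derivTens Q (t + braid (Q 0 0 : 𝕜) (Q 0 1) (Q 1 0) (Q 1 1) t) := by
  suffices h : skewDeriv Q 1 ∘ₗ mulTens Q = derivTens Q ∘ₗ
      (LinearMap.id + braid (Q 0 0 : 𝕜) (Q 0 1) (Q 1 0) (Q 1 1)) from DFunLike.congr_fun h t
  refine tens_hom_ext fun i j => ?_
  simp only [LinearMap.comp_apply, LinearMap.add_apply, LinearMap.id_apply, map_add,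
    mulTens_tens, derivTens_tens, braid_tens, derivTens_braidTens, skewDeriv_mul,
    skewDeriv_one_adGen, scale_adGen, mul_smul_comm, smul_mul_assoc, smul_smul]

lemma skewDeriv_zero_mulTens (t : ℕ × ℕ →₀ 𝕜) : skewDeriv Q 0 (mulTens Q t) = 0 := by
  suffices h : skewDeriv Q 0 ∘ₗ mulTens Q = 0 from DFunLike.congr_fun h t
  exact tens_hom_ext fun i j => by simp [skewDeriv_mul, skewDeriv_zero_adGen]

lemma counit_mulTens (t : ℕ × ℕ →₀ 𝕜) : counit Q (mulTens Q t) = 0 := by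
  suffices h : (counit Q).toLinearMap ∘ₗ mulTens Q = 0 from DFunLike.congr_fun h t
  exact tens_hom_ext fun i j => by simp

variable {Q}

lemma bCoeff_ne_zero {q r : 𝕜} {m : ℕ} (hy : ∀ k, k < m → lowerCoeff q r (k + 1) ≠ 0) :
    bCoeff q r m ≠ 0 := by
  rw [bCoeff, Finset.prod_ne_zero_iff]
  intro k hk
  have := hy k (Finset.mem_range.mp hk)
  rw [lowerCoeff_succ] at this
  exact right_ne_zero_of_mul this

lemma gen_pow_ne_zero {m : ℕ}
    (hy : ∀ k, k < m → lowerCoeff (Q 0 0 : 𝕜) (Q 0 1 * Q 1 0) (k + 1) ≠ 0) :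
    gen Q 0 ^ m ≠ 0 := by
  induction m with
  | zero =>
    intro h
    simpa using congrArg (counit Q) h
  | succ m ih =>
    intro h
    have h1 := skewDeriv_zero_gen_pow Q m
    rw [h, map_zero] at h1
    exact smul_ne_zero (geomSum_ne_zero hy (Nat.lt_succ_self m))
      (ih fun k hk => hy k (by omega)) h1.symm

lemma adGen_ne_zero {m : ℕ}
    (hy : ∀ k, k < m → lowerCoeff (Q 0 0 : 𝕜) (Q 0 1 * Q 1 0) (k + 1) ≠ 0) :
    adGen Q m ≠ 0 := by
  intro h
  have h1 := skewDeriv_one_adGen Q m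
  rw [h, map_zero] at h1
  exact smul_ne_zero (bCoeff_ne_zero hy) (gen_pow_ne_zero hy) h1.symm

/-- The derivation ∂_1 kills u_i and lowers the power of x_1, so by induction all coefficients with
positive second index vanish. A multiple of u_m remains, and u_m ≠ 0. -/
lemma eq_zero_of_derivTens {m : ℕ}
    (hy : ∀ k, k < m → lowerCoeff (Q 0 0 : 𝕜) (Q 0 1 * Q 1 0) (k + 1) ≠ 0)
    {t : ℕ × ℕ →₀ 𝕜} (ht : t ∈ homTens 𝕜 m) (h : derivTens Q t = 0) : t = 0 := by
  have top : ∀ {m : ℕ}, (∀ k, k < m → lowerCoeff (Q 0 0 : 𝕜) (Q 0 1 * Q 1 0) (k + 1) ≠ 0) →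
      ∀ {t : ℕ × ℕ →₀ 𝕜}, t ∈ homTens 𝕜 m → derivTens Q t = 0 →
      (∀ i j, t (i, j + 1) = 0) → t = 0 := by
    intro m hy t ht h h0
    have e : t = t (m, 0) • tens m 0 := by
      ext ⟨i, j⟩
      rw [Finsupp.smul_apply, tens_apply]
      cases j with
      | zero =>
        by_cases hi : m = i
        · simp [hi]
        · rw [mem_homTens.mp ht i 0 (by omega)]
          simp [hi]
      | succ j => simp [h0]
    have h2 := h
    rw [e, map_smul, derivTens_tens] at h2
    simp only [bCoeff, Finset.range_zero, Finset.prod_empty, one_smul, pow_zero, mul_one] at h2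
    rw [e, (smul_eq_zero.mp h2).resolve_right (adGen_ne_zero hy), zero_smul]
  induction m generalizing t with
  | zero => exact top hy ht h fun i j => mem_homTens.mp ht _ _ (by omega)
  | succ m ih =>
    let δ : (ℕ × ℕ →₀ 𝕜) →ₗ[𝕜] (ℕ × ℕ →₀ 𝕜) := Finsupp.linearCombination 𝕜 fun p =>
      lowerCoeff (Q 0 0 : 𝕜) (Q 0 1 * Q 1 0) p.2 • tens p.1 (p.2 - 1)
    have hδ : ∀ i j, δ (tens i j) =
        lowerCoeff (Q 0 0 : 𝕜) (Q 0 1 * Q 1 0) j • tens i (j - 1) := fun i j => by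
      simp [δ, tens]
    have hcomm : skewDeriv Q 0 ∘ₗ derivTens Q = derivTens Q ∘ₗ δ := by
      refine tens_hom_ext fun i j => ?_
      rw [LinearMap.comp_apply, LinearMap.comp_apply, hδ, derivTens_tens, map_smul, map_smul,
        skewDeriv_mul, skewDeriv_zero_adGen, zero_mul, add_zero]
      cases j with
      | zero => simp [lowerCoeff]
      | succ j =>
        rw [skewDeriv_zero_gen_pow, lowerCoeff_succ, bCoeff_succ, Nat.add_sub_cancel,
          derivTens_tens, mul_smul_comm]
        module
    have hmem : δ t ∈ homTens 𝕜 m := by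
      refine map_supported_mem δ (fun i j hij => ?_) ht
      have hij' : i + j = m + 1 := hij
      rw [hδ]
      cases j with
      | zero => simp [lowerCoeff]
      | succ j => exact Submodule.smul_mem _ _ (tens_mem_homTens' (by omega))
    have hzero : δ t = 0 := by
      refine ih (fun k hk => hy k (by omega)) hmem ?_
      have := DFunLike.congr_fun hcomm t
      rw [LinearMap.comp_apply, LinearMap.comp_apply, h, map_zero] at this
      exact this.symm
    have happ : ∀ i j, δ t (i, j) =
        lowerCoeff (Q 0 0 : 𝕜) (Q 0 1 * Q 1 0) (j + 1) * t (i, j + 1) := by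
      intro i j
      have : Finsupp.lapply (i, j) ∘ₗ δ = lowerCoeff (Q 0 0 : 𝕜) (Q 0 1 * Q 1 0) (j + 1) •
          (Finsupp.lapply (i, j + 1) : (ℕ × ℕ →₀ 𝕜) →ₗ[𝕜] 𝕜) := by
        refine tens_hom_ext fun k l => ?_
        simp only [LinearMap.comp_apply, hδ, LinearMap.smul_apply, Finsupp.lapply_apply,
          Finsupp.smul_apply, tens_apply, smul_eq_mul]
        rcases l with _ | l
        · simp [lowerCoeff]
        · by_cases hl : l = j
          · subst hl; simp
          · simp [hl]
      exact DFunLike.congr_fun this t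
    refine top hy ht h fun i j => ?_
    by_cases hij : i + (j + 1) = m + 1
    · have := happ i j
      rw [hzero, Finsupp.zero_apply] at this
      exact (mul_eq_zero.mp this.symm).resolve_left (hy j (by omega))
    · exact mem_homTens.mp ht _ _ hij

/-- The relations between the products `u_i u_j` are given by the eigenvalue `-1` of the
braiding. -/
theorem mulTens_eq_zero_iff {m : ℕ}
    (hy : ∀ k, k < m → lowerCoeff (Q 0 0 : 𝕜) (Q 0 1 * Q 1 0) (k + 1) ≠ 0)
    {t : ℕ × ℕ →₀ 𝕜} (ht : t ∈ homTens 𝕜 m) : mulTens Q t = 0 ↔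
      t ∈ relTens (Q 0 0 : 𝕜) (Q 0 1) (Q 1 0) (Q 1 1) m := by
  rw [mem_relTens]
  constructor
  · intro h
    refine ⟨ht, eq_zero_of_derivTens hy (Submodule.add_mem _ ht (braid_mem _ _ _ _ ht)) ?_⟩
    rw [← skewDeriv_one_mulTens, h, map_zero]
  · rintro ⟨-, h⟩
    refine eq_zero_of_skewDeriv (counit_mulTens Q t) fun i => ?_
    rcases Fin.exists_fin_two.mp ⟨i, rfl⟩ with hi | hi
    · rw [hi]; exact skewDeriv_zero_mulTens Q t
    · rw [hi, skewDeriv_one_mulTens, h, map_zero]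

end Products

/-! ### Root vector candidates of degree at most two in the second letter -/

section Candidates

variable {𝕜 : Type*} [Field 𝕜]

/-- A tensor representing the root vector candidate with word `0^a 1 0^b 1`. -/
def candTens (Q : Fin 2 → Fin 2 → 𝕜ˣ) (a b : ℕ) : ℕ × ℕ →₀ 𝕜 :=
  if a = b then tens a a else
    (raise (Q 0 0 : 𝕜) (Q 0 1) ^ (a - b - 1)) (tens (b + 1) b -
      ((Q 0 0 : 𝕜) ^ ((b + 1) * b) * (Q 0 1 : 𝕜) ^ (b + 1) * ((Q 1 0 : 𝕜) ^ b * (Q 1 1 : 𝕜))) •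
        tens b (b + 1))

variable (Q : Fin 2 → Fin 2 → 𝕜ˣ)

lemma candTens_self (a : ℕ) : candTens Q a a = tens a a := by simp [candTens]

lemma candTens_succ (b : ℕ) : candTens Q (b + 1) b = tens (b + 1) b -
      ((Q 0 0 : 𝕜) ^ ((b + 1) * b) * (Q 0 1 : 𝕜) ^ (b + 1) * ((Q 1 0 : 𝕜) ^ b * (Q 1 1 : 𝕜))) •
        tens b (b + 1) := by
  simp [candTens]

lemma candTens_raise {a b : ℕ} (h : b < a) :
    candTens Q (a + 1) b = raise (Q 0 0 : 𝕜) (Q 0 1) (candTens Q a b) := by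
  rw [candTens, candTens, if_neg (by omega), if_neg (by omega)]
  have : a + 1 - b - 1 = (a - b - 1) + 1 := by omega
  rw [this, pow_succ', Module.End.mul_apply]

lemma candTens_mem {a b : ℕ} (h : b ≤ a) : candTens Q a b ∈ homTens 𝕜 (a + b) := by
  rcases h.eq_or_lt with rfl | h'
  · rw [candTens_self]; exact tens_mem_homTens _ _
  · clear h
    induction a, h' using Nat.le_induction with
    | base =>
      rw [candTens_succ]
      exact Submodule.sub_mem _ (tens_mem_homTens _ _)
        (Submodule.smul_mem _ _ (tens_mem_homTens' (by omega)))
    | succ a h ih =>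
      rw [candTens_raise Q h, add_right_comm]
      exact raise_mem _ _ ih

lemma candTens_apply_eq_zero {a b i j : ℕ} (h : b ≤ a) (hij : a < i ∨ a < j) :
    candTens Q a b (i, j) = 0 := by
  rcases h.eq_or_lt with rfl | h'
  · rw [candTens_self, tens_apply, if_neg (by omega)]
  · clear h
    induction a, h' using Nat.le_induction generalizing i j with
    | base =>
      rw [candTens_succ, Finsupp.sub_apply, Finsupp.smul_apply, tens_apply, tens_apply,
        if_neg (by omega), if_neg (by omega), smul_zero, sub_zero]
    | succ a h ih =>
      rw [candTens_raise Q h, raise_apply]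
      have h1 : (if i = 0 then 0 else candTens Q a b (i - 1, j)) = 0 := by
        split_ifs
        · rfl
        · exact ih (by omega)
      have h2 : (if j = 0 then 0 else
          (Q 0 0 : 𝕜) ^ i * (Q 0 1 : 𝕜) * candTens Q a b (i, j - 1)) = 0 := by
        split_ifs
        · rfl
        · rw [ih (by omega), mul_zero]
      rw [h1, h2, add_zero]

lemma candTens_apply_top {a b : ℕ} (h : b ≤ a) : candTens Q a b (a, b) = 1 := by
  rcases h.eq_or_lt with rfl | h'
  · simp [candTens_self, tens_apply]
  · clear h
    induction a, h' using Nat.le_induction with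
    | base => simp [candTens_succ, tens_apply]
    | succ a h ih =>
      rw [candTens_raise Q h, raise_apply, if_neg (by omega), Nat.add_sub_cancel,
        ih, candTens_apply_eq_zero Q (Nat.le_of_lt h) (Or.inl (by omega))]
      simp

/-- The same value is forced on relations with leading index a by `relTens_apply_bot`, so
subtracting such a relation also clears this coefficient. -/
lemma candTens_apply_bot {a b : ℕ} (h : b < a) : candTens Q a b (b, a) =
    -((Q 1 1 : 𝕜) * (Q 1 0 : 𝕜) ^ b * ((Q 0 0 : 𝕜) ^ b * (Q 0 1 : 𝕜)) ^ a) := by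
  induction a, h using Nat.le_induction with
  | base =>
    rw [candTens_succ, Finsupp.sub_apply, Finsupp.smul_apply, tens_apply, tens_apply,
      if_neg (by omega), if_pos ⟨rfl, rfl⟩, smul_eq_mul, Nat.succ_eq_add_one]
    ring
  | succ a h ih =>
    rw [candTens_raise Q h, raise_apply, Nat.add_sub_cancel, ih, if_neg (Nat.succ_ne_zero a)]
    have : (if b = 0 then 0 else candTens Q a b (b - 1, a + 1)) = 0 := by
      split_ifs
      · rfl
      · exact candTens_apply_eq_zero Q (Nat.le_of_lt h) (Or.inr (by omega))
    rw [this]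
    ring

lemma superLetter_wordTwo {a b : ℕ} (h : b < a) :
    superLetter Q (wordTwo a b) = mulTens Q (candTens Q a b) := by
  induction a, h using Nat.le_induction with
  | base => rw [superLetter_wordTwo_succ, candTens_succ]; simp
  | succ a h ih =>
    rw [superLetter_wordTwo_cons Q h, candTens_raise Q h,
      mulTens_raise Q (candTens_mem Q (Nat.le_of_lt h)), ih]

variable {Q}

lemma degree_flatten_replicate (k : ℕ) (u : List (Fin 2)) :
    degree (List.replicate k u).flatten = k • degree u := by
  induction k with
  | zero => ext; simp [degree]
  | succ k ih => rw [List.replicate_succ, List.flatten_cons, degree_append, ih, succ_nsmul']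

namespace Candidate

lemma degree_word (c : Candidate Q) : degree c.word = c.exponent • degree c.base :=
  degree_flatten_replicate _ _

lemma vec_mem_graded (c : Candidate Q) : c.vec ∈ graded Q (degree c.word) := by
  rw [degree_word]
  exact pow_mem_graded (superLetter_mem_graded _) _

lemma count_word (c : Candidate Q) (i : Fin 2) :
    c.word.count i = c.exponent * c.base.count i := by
  simpa [degree] using congrFun c.degree_word i

lemma eq_wordOne (c : Candidate Q) (h : c.word.count 1 = 1) :
    ∃ j, c.word = wordOne j ∧ c.vec = adGen Q j := by
  rw [count_word] at h
  obtain ⟨h1, h2⟩ := mul_eq_one.mp h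
  obtain ⟨j, hj⟩ := c.lyndon.eq_wordOne h2
  refine ⟨j, ?_, ?_⟩
  · simp [word, h1, hj]
  · rw [vec, h1, hj, pow_one, adGen]

/-- The candidate `[0^j 1]`. -/
def one (Q : Fin 2 → Fin 2 → 𝕜ˣ) (j : ℕ) : Candidate Q :=
  ⟨wordOne j, 1, isLyndon_wordOne j, Or.inl rfl⟩

@[simp] lemma word_one (j : ℕ) : (one Q j).word = wordOne j := by simp [word, one]

@[simp] lemma vec_one (j : ℕ) : (one Q j).vec = adGen Q j := by simp [vec, one, adGen]

/-- The candidate `[0^a 1 0^b 1]` for `b < a`. -/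
def two (Q : Fin 2 → Fin 2 → 𝕜ˣ) {a b : ℕ} (h : b < a) : Candidate Q :=
  ⟨wordTwo a b, 1, isLyndon_wordTwo h, Or.inl rfl⟩

@[simp] lemma word_two {a b : ℕ} (h : b < a) : (two Q h).word = wordTwo a b := by
  simp [word, two]

@[simp] lemma vec_two {a b : ℕ} (h : b < a) : (two Q h).vec = mulTens Q (candTens Q a b) := by
  simp [vec, two, superLetter_wordTwo Q h]

variable [CharZero 𝕜]

lemma orderOf_chi_eq_two_iff (a : ℕ) : orderOf (chi Q ![a, 1] ![a, 1]) = 2 ↔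
    (Q 0 0 : 𝕜) ^ (a ^ 2) * (Q 0 1 * Q 1 0 : 𝕜) ^ a * Q 1 1 = -1 := by
  have e : (Q 0 0 : 𝕜) ^ (a ^ 2) * (Q 0 1 * Q 1 0 : 𝕜) ^ a * Q 1 1 =
      (chi Q ![a, 1] ![a, 1] : 𝕜) := by
    rw [chi_cons]; ring
  rw [e]
  generalize chi Q ![a, 1] ![a, 1] = x
  rw [orderOf_eq_prime_iff]
  constructor
  · rintro ⟨h1, h2⟩
    have h3 : (x : 𝕜) * x = 1 := by
      rw [← sq, ← Units.val_pow_eq_pow_val, h1, Units.val_one]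
    rcases mul_self_eq_one_iff.mp h3 with h | h
    · exact absurd (Units.ext h) h2
    · exact h
  · intro h
    refine ⟨Units.ext ?_, ?_⟩
    · simp [h]
    · rintro rfl
      rw [Units.val_one] at h
      norm_num [eq_neg_iff_add_eq_zero] at h

lemma eq_wordTwo (c : Candidate Q) (h : c.word.count 1 = 2) :
    ∃ a b, (b < a ∨ (b = a ∧
      (Q 0 0 : 𝕜) ^ (a ^ 2) * (Q 0 1 * Q 1 0 : 𝕜) ^ a * Q 1 1 = -1)) ∧
      c.word = wordTwo a b ∧ c.vec = mulTens Q (candTens Q a b) := by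
  rw [count_word] at h
  have hdvd : c.exponent ∣ 2 := ⟨_, h.symm⟩
  rcases (Nat.dvd_prime Nat.prime_two).mp hdvd with h1 | h1
  · rw [h1, one_mul] at h
    obtain ⟨a, b, hab, hw⟩ := c.lyndon.eq_wordTwo h
    refine ⟨a, b, Or.inl hab, ?_, ?_⟩
    · simp [word, h1, hw]
    · rw [vec, h1, hw, pow_one, superLetter_wordTwo Q hab]
  · rw [h1] at h
    obtain ⟨j, hj⟩ := c.lyndon.eq_wordOne (by omega)
    refine ⟨j, j, Or.inr ⟨rfl, ?_⟩, ?_, ?_⟩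
    · have := c.admissible
      rw [h1, hj, degree_wordOne] at this
      rcases this with h2 | ⟨-, e, h2⟩
      · omega
      · rw [ringExpChar.eq 𝕜 1, one_pow, mul_one] at h2
        exact (orderOf_chi_eq_two_iff j).mp h2.symm
    · simp [word, h1, hj, wordTwo, wordOne]
    · rw [vec, h1, hj, candTens_self, mulTens_tens, sq, adGen]

/-- The candidate `[(0^a 1)^2]`. -/
def square (a : ℕ)
    (h : (Q 0 0 : 𝕜) ^ (a ^ 2) * (Q 0 1 * Q 1 0 : 𝕜) ^ a * Q 1 1 = -1) : Candidate Q :=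
  ⟨wordOne a, 2, isLyndon_wordOne a, Or.inr (by
    rw [degree_wordOne, (orderOf_chi_eq_two_iff a).mpr h]
    exact ⟨two_pos, 0, by simp⟩)⟩

lemma word_square (a : ℕ)
    (h : (Q 0 0 : 𝕜) ^ (a ^ 2) * (Q 0 1 * Q 1 0 : 𝕜) ^ a * Q 1 1 = -1) :
    (square a h).word = wordTwo a a := by
  simp [word, square, wordTwo, wordOne]

end Candidate

/-! ### The span of the larger monomials -/

/-- Index pairs of degree `m` with both entries smaller than `a`. -/
def lowerPairs (a m : ℕ) : Set (ℕ × ℕ) := {p | p.1 + p.2 = m ∧ p.1 < a ∧ p.2 < a}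

lemma eq_zero_of_mem_graded {α β : Fin 2 → ℕ} (h : α ≠ β) {x : NicholsAlgebra Q}
    (hα : x ∈ graded Q α) (hβ : x ∈ graded Q β) : x = 0 := by
  refine eq_zero_of_coefficient fun w => ?_
  by_cases hw : degree w = α
  · exact coefficient_graded_eq_zero (by rw [hw]; exact h) hβ
  · exact coefficient_graded_eq_zero hw hα

lemma prod_mem_graded (l : List (Candidate Q × ℕ)) :
    (l.map fun c => c.1.vec ^ c.2).prod ∈
      graded Q ((l.map fun c => c.2 • degree c.1.word).sum) := by
  induction l with
  | nil => exact one_mem_graded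
  | cons c l ih =>
    simp only [List.map_cons, List.prod_cons, List.sum_cons]
    exact mul_mem_graded (pow_mem_graded c.1.vec_mem_graded _) ih

/-- Powers of the letter 0 are smaller than any word containing 1. Hence larger monomials of this
degree involve no factor x_1 and have at most two factors. -/
lemma one_le_count_of_lt {a b : ℕ} {v : List (Fin 2)} (h : wordTwo a b < v) : 1 ≤ v.count 1 := by
  by_contra hc
  rw [eq_replicate_of_count (x := v) (by omega)] at h
  exact List.lt_irrefl _ (List.lt_trans h (replicate_lt v.length a (wordOne b)))

lemma candTens_mem_lowerPairs {a b c m : ℕ} (h : b ≤ a) (hm : a + b = m) (hc : a < c) :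
    candTens Q a b ∈ Finsupp.supported 𝕜 𝕜 (lowerPairs c m) := by
  rw [Finsupp.mem_supported']
  rintro ⟨i, j⟩ hij
  by_cases hs : i + j = m
  · refine candTens_apply_eq_zero Q h ?_
    by_contra hn
    exact hij ⟨hs, by dsimp only; omega, by dsimp only; omega⟩
  · exact mem_homTens.mp (hm ▸ candTens_mem Q h) i j hs

lemma tens_mem_lowerPairs {i j c m : ℕ} (hm : i + j = m) (hi : i < c) (hj : j < c) :
    (tens i j : ℕ × ℕ →₀ 𝕜) ∈ Finsupp.supported 𝕜 𝕜 (lowerPairs c m) :=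
  Finsupp.single_mem_supported 𝕜 _ ⟨hm, hi, hj⟩

lemma largerMonomials_subset [CharZero 𝕜] {a b m : ℕ} (hab : b ≤ a) (hm : a + b = m) :
    Candidate.largerMonomials Q (wordTwo a b) ∩ graded Q ![m, 2] ⊆
      (Finsupp.supported 𝕜 𝕜 (lowerPairs a m)).map (mulTens Q) := by
  rintro x ⟨⟨l, -, hl, rfl⟩, hx⟩
  by_cases hdeg : (l.map fun c => c.2 • degree c.1.word).sum = ![m, 2]
  swap
  · rw [eq_zero_of_mem_graded hdeg (prod_mem_graded l) hx]
    exact Submodule.zero_mem _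
  clear hx
  have key : ∀ c ∈ l, 1 ≤ c.2 ∧ 1 ≤ c.1.word.count 1 := fun c hc =>
    ⟨(hl c hc).2, one_le_count_of_lt (hl c hc).1⟩
  have hle : ∀ {j : ℕ} {c : Candidate Q}, wordTwo a b < c.word → c.word = wordOne j → j < a := by
    intro j c h1 h2
    rw [h2, wordTwo_lt_wordOne_iff] at h1
    exact h1
  match l with
  | [] => simpa using congrFun hdeg 1
  | [(c, k)] =>
    have h0 := congrFun hdeg 0
    have h1 := congrFun hdeg 1
    simp only [degree, List.map_cons, List.map_nil, List.sum_cons, List.sum_nil, Pi.add_apply,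
      Pi.smul_apply, Pi.zero_apply, add_zero, smul_eq_mul, Matrix.cons_val_zero,
      Matrix.cons_val_one] at h0 h1
    have hw := (hl (c, k) (by simp)).1
    have hdvd : k ∣ 2 := ⟨_, h1.symm⟩
    simp only [List.map_cons, List.map_nil, List.prod_cons, List.prod_nil, mul_one]
    rcases (Nat.dvd_prime Nat.prime_two).mp hdvd with rfl | rfl
    · rw [one_mul] at h0 h1
      obtain ⟨a', b', hab', hword, hvec⟩ := c.eq_wordTwo h1
      rw [hword, wordTwo_lt_wordTwo_iff] at hw
      have hsum : a' + b' = m := by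
        have := congrFun (degree_wordTwo a' b') 0
        rw [← hword] at this
        simpa [degree, h0] using this.symm
      rw [hvec, pow_one]
      exact Submodule.mem_map_of_mem (candTens_mem_lowerPairs (by omega) hsum (by omega))
    · obtain ⟨j, hword, hvec⟩ := c.eq_wordOne (by omega)
      have hj := hle hw hword
      have hsum : 2 * j = m := by
        have := congrFun (degree_wordOne j) 0
        rw [← hword] at this
        rw [← h0]
        simp [degree] at this
        omega
      rw [hvec, sq, ← mulTens_tens]
      exact Submodule.mem_map_of_mem (tens_mem_lowerPairs (by omega) hj hj)
  | [(c, k), (c', k')] =>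
    have h0 := congrFun hdeg 0
    have h1 := congrFun hdeg 1
    simp only [degree, List.map_cons, List.map_nil, List.sum_cons, List.sum_nil, Pi.add_apply,
      Pi.smul_apply, add_zero, smul_eq_mul, Matrix.cons_val_zero,
      Matrix.cons_val_one] at h0 h1
    obtain ⟨hk, hc⟩ := key (c, k) (by simp)
    obtain ⟨hk', hc'⟩ := key (c', k') (by simp)
    dsimp only at hk hc hk' hc'
    have e1 : 1 ≤ k * c.word.count 1 := Nat.mul_pos hk hc
    have e2 : 1 ≤ k' * c'.word.count 1 := Nat.mul_pos hk' hc'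
    obtain ⟨rfl, hc⟩ := mul_eq_one.mp (show k * c.word.count 1 = 1 by omega)
    obtain ⟨rfl, hc'⟩ := mul_eq_one.mp (show k' * c'.word.count 1 = 1 by omega)
    obtain ⟨i, hword, hvec⟩ := c.eq_wordOne hc
    obtain ⟨j, hword', hvec'⟩ := c'.eq_wordOne hc'
    have hi := hle (hl (c, 1) (by simp)).1 hword
    have hj := hle (hl (c', 1) (by simp)).1 hword'
    have hsum : i + j = m := by
      have f1 := congrFun (degree_wordOne i) 0
      have f2 := congrFun (degree_wordOne j) 0
      rw [← hword] at f1
      rw [← hword'] at f2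
      simp only [degree, Matrix.cons_val_zero] at f1 f2
      omega
    simp only [List.map_cons, List.map_nil, List.prod_cons, List.prod_nil, mul_one, pow_one]
    rw [hvec, hvec', ← mulTens_tens]
    exact Submodule.mem_map_of_mem (tens_mem_lowerPairs hsum hi hj)
  | c₁ :: c₂ :: c₃ :: l =>
    exfalso
    have h1 := congrFun hdeg 1
    simp only [degree, List.map_cons, List.sum_cons, Pi.add_apply, Pi.smul_apply, smul_eq_mul,
      Matrix.cons_val_one] at h1
    obtain ⟨hk₁, hc₁⟩ := key c₁ (by simp)
    obtain ⟨hk₂, hc₂⟩ := key c₂ (by simp)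
    obtain ⟨hk₃, hc₃⟩ := key c₃ (by simp)
    have e1 : 1 ≤ c₁.2 * c₁.1.word.count 1 := Nat.mul_pos hk₁ hc₁
    have e2 : 1 ≤ c₂.2 * c₂.1.word.count 1 := Nat.mul_pos hk₂ hc₂
    have e3 : 1 ≤ c₃.2 * c₃.1.word.count 1 := Nat.mul_pos hk₃ hc₃
    simp at h1
    omega

/-- Products with i ≤ j are already ordered monomials. For i > j the product is the candidate 0^i 1
0^j 1 plus products with smaller first index. -/
lemma adGen_mul_adGen_mem_span {a b : ℕ} (i j : ℕ) (hi : i < a) (hj : j < a)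
    (hsum : i + j = a + b) : adGen Q i * adGen Q j ∈
      Submodule.span 𝕜 (Candidate.largerMonomials Q (wordTwo a b)) := by
  induction i using Nat.strong_induction_on generalizing j with
  | _ i ih =>
    rcases lt_trichotomy i j with h | rfl | h
    · refine Submodule.subset_span ⟨[(Candidate.one Q i, 1), (Candidate.one Q j, 1)], ?_, ?_, ?_⟩
      · simpa [wordOne_lt_wordOne_iff] using h
      · simp [wordTwo_lt_wordOne_iff, hi, hj]
      · simp
    · refine Submodule.subset_span ⟨[(Candidate.one Q i, 2)], by simp, ?_, ?_⟩
      · simp [wordTwo_lt_wordOne_iff, hi]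
      · simp [sq]
    · have h1 : mulTens Q (candTens Q i j) ∈
          Submodule.span 𝕜 (Candidate.largerMonomials Q (wordTwo a b)) := by
        refine Submodule.subset_span ⟨[(Candidate.two Q h, 1)], by simp, ?_, ?_⟩
        · simp [wordTwo_lt_wordTwo_iff, hi]
        · simp
      have h2 : mulTens Q (candTens Q i j - tens i j) ∈
          Submodule.span 𝕜 (Candidate.largerMonomials Q (wordTwo a b)) := by
        refine map_supported_mem (mulTens Q) (A := {p | p.1 + p.2 = a + b ∧ p.1 < i ∧ p.2 ≤ i})
          (fun k l hkl => ?_) ?_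
        · obtain ⟨e1, e2, e3⟩ : k + l = a + b ∧ k < i ∧ l ≤ i := hkl
          rw [mulTens_tens]
          exact ih k e2 l (by omega) (by omega) e1
        · rw [Finsupp.mem_supported']
          rintro ⟨k, l⟩ hkl
          rw [Finsupp.sub_apply, tens_apply]
          by_cases e : i = k ∧ j = l
          · rw [if_pos e, ← e.1, ← e.2, candTens_apply_top Q h.le, sub_self]
          · rw [if_neg e, sub_zero]
            by_cases e1 : k + l = i + j
            · refine candTens_apply_eq_zero Q h.le ?_
              by_contra hn
              exact hkl ⟨by dsimp only; omega, by dsimp only; omega, by dsimp only; omega⟩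
            · exact mem_homTens.mp (candTens_mem Q h.le) k l e1
      have h3 := Submodule.sub_mem _ h1 h2
      rw [map_sub, sub_sub_cancel, mulTens_tens] at h3
      exact h3

end Candidates

/-! ### Leading terms of relations -/

section Leading

variable {𝕜 : Type*} [Field 𝕜]

/-- The index `a` is the leading index of some tensor of degree `m` in `R`. -/
def IsLeading (R : Submodule 𝕜 (ℕ × ℕ →₀ 𝕜)) (m a : ℕ) : Prop :=
  ∃ t ∈ R, t (a, m - a) = 1 ∧ ∀ i j, a < i → t (i, j) = 0

open Classical in
/-- The dimension of a space of tensors of degree `m` is the number of its leading indices. -/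
lemma finrank_eq_card_isLeading {m : ℕ} {R : Submodule 𝕜 (ℕ × ℕ →₀ 𝕜)} (hR : R ≤ homTens 𝕜 m) :
    Module.finrank 𝕜 R = ((Finset.range (m + 1)).filter (IsLeading R m)).card := by
  let coords : R →ₗ[𝕜] (Fin (m + 1) → 𝕜) :=
    LinearMap.pi fun i => Finsupp.lapply ((i : ℕ), m - i) ∘ₗ R.subtype
  have hinj : Function.Injective coords := by
    rw [injective_iff_map_eq_zero]
    rintro ⟨t, ht⟩ h
    refine Subtype.ext (Finsupp.ext fun ⟨i, j⟩ => ?_)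
    by_cases hij : i + j = m
    · have := congrFun h ⟨i, by omega⟩
      have e : m - i = j := by omega
      simpa [coords, e] using this
    · exact mem_homTens.mp (hR ht) i j hij
  have hfin : FiniteDimensional 𝕜 R := Module.Finite.of_injective coords hinj
  -- Filtration by first index: in a fixed degree each step adds a single coordinate, so the
  -- dimension grows by one exactly at leading indices.
  let Z : ℕ → Submodule 𝕜 (ℕ × ℕ →₀ 𝕜) := fun N =>
    R ⊓ Finsupp.supported 𝕜 𝕜 {p | p.1 < N}
  have hZ : ∀ N t, t ∈ Z N ↔ t ∈ R ∧ ∀ i j, N ≤ i → t (i, j) = 0 := by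
    intro N t
    simp [Z, Finsupp.mem_supported']
  have hZfin : ∀ N, FiniteDimensional 𝕜 (Z N) := fun N =>
    Submodule.finiteDimensional_of_le (inf_le_left : Z N ≤ R)
  have key : ∀ N, Module.finrank 𝕜 (Z N) =
      ((Finset.range N).filter (IsLeading R m)).card := by
    intro N
    induction N with
    | zero =>
      have : Z 0 = ⊥ := by
        rw [eq_bot_iff]
        intro t ht
        rw [hZ] at ht
        exact Finsupp.ext fun ⟨i, j⟩ => ht.2 i j (Nat.zero_le i)
      rw [this]
      simp
    | succ N ih =>
      have hle : Z N ≤ Z (N + 1) := fun t ht => by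
        rw [hZ] at ht ⊢
        exact ⟨ht.1, fun i j hi => ht.2 i j (by omega)⟩
      let φ : Z (N + 1) →ₗ[𝕜] 𝕜 := Finsupp.lapply (N, m - N) ∘ₗ (Z (N + 1)).subtype
      have hφ : ∀ t : Z (N + 1), φ t = (t : ℕ × ℕ →₀ 𝕜) (N, m - N) := fun t => rfl
      have hker : (LinearMap.ker φ).map (Z (N + 1)).subtype = Z N := by
        ext t
        constructor
        · rintro ⟨⟨t, ht⟩, h0, rfl⟩
          have h1 : t (N, m - N) = 0 := h0
          rw [hZ] at ht
          rw [Submodule.subtype_apply, hZ]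
          refine ⟨ht.1, fun i j hi => ?_⟩
          rcases hi.eq_or_lt with rfl | hi
          · by_cases hij : N + j = m
            · have e : j = m - N := by omega
              rw [e]; exact h1
            · exact mem_homTens.mp (hR ht.1) _ _ hij
          · exact ht.2 i j hi
        · intro ht
          refine ⟨⟨t, hle ht⟩, ?_, rfl⟩
          exact ((hZ N t).mp ht).2 N _ le_rfl
      have hrank := LinearMap.finrank_range_add_finrank_ker (K := 𝕜) (V := Z (N + 1)) (V₂ := 𝕜) φ
      rw [← Submodule.finrank_map_subtype_eq (Z (N + 1)) (LinearMap.ker φ), hker, ih] at hrank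
      rw [Finset.range_add_one, Finset.filter_insert]
      by_cases hN : IsLeading R m N
      · rw [if_pos hN, Finset.card_insert_of_notMem (by simp), ← hrank, add_comm]
        congr 1
        have : LinearMap.range φ = ⊤ := by
          rw [LinearMap.range_eq_top]
          obtain ⟨t, htR, ht1, ht⟩ := hN
          have htZ : t ∈ Z (N + 1) := (hZ _ _).mpr ⟨htR, fun i j hi => ht i j hi⟩
          intro c
          refine ⟨c • ⟨t, htZ⟩, ?_⟩
          rw [map_smul, hφ, ht1, smul_eq_mul, mul_one]
        rw [this, finrank_top, Module.finrank_self]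
      · rw [if_neg hN, ← hrank]
        have : LinearMap.range φ = ⊥ := by
          rw [LinearMap.range_eq_bot]
          ext ⟨t, ht⟩
          by_contra h0
          have h1 : t (N, m - N) ≠ 0 := h0
          rw [hZ] at ht
          refine hN ⟨(t (N, m - N))⁻¹ • t, Submodule.smul_mem _ _ ht.1, ?_, fun i j hi => ?_⟩
          · rw [Finsupp.smul_apply, smul_eq_mul, inv_mul_cancel₀ h1]
          · rw [Finsupp.smul_apply, ht.2 i j hi, smul_zero]
        rw [this, finrank_bot, zero_add]
  have htop : Z (m + 1) = R := by
    refine le_antisymm inf_le_left fun t ht => (hZ _ _).mpr ⟨ht, fun i j hi => ?_⟩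
    exact mem_homTens.mp (hR ht) i j (by omega)
  rw [← key, htop]

variable {q a d s : 𝕜}

lemma relTens_le_homTens (m : ℕ) : relTens q a d s m ≤ homTens 𝕜 m := inf_le_left

/-- On the extreme coefficient the braiding swaps the two indices up to a scalar, so a bound on the
first indices of a relation also bounds its second indices. -/
lemma relTens_apply_eq_zero {m k : ℕ} {t : ℕ × ℕ →₀ 𝕜} (ht : t ∈ relTens q a d s m)
    (h : ∀ i j, k < i → t (i, j) = 0) (i j : ℕ) (hj : k < j) : t (i, j) = 0 := by
  obtain ⟨h1, h2⟩ := mem_relTens.mp ht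
  by_cases hij : j + i = m
  · subst hij
    have h3 := braid_apply_low q a d s h1 (fun k l hk => h k l (by omega))
    have h4 := DFunLike.congr_fun h2 (i, j)
    rw [Finsupp.add_apply, h3, h j i hj, mul_zero, add_zero] at h4
    exact h4
  · exact mem_homTens.mp h1 i j (by omega)

lemma relTens_apply_bot {k l : ℕ} {t : ℕ × ℕ →₀ 𝕜} (ht : t ∈ relTens q a d s (k + l))
    (h : ∀ i j, k < i → t (i, j) = 0) :
    t (l, k) = -(s * d ^ l * (q ^ l * a) ^ k * t (k, l)) := by
  obtain ⟨h1, h2⟩ := mem_relTens.mp ht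
  have h4 := DFunLike.congr_fun h2 (l, k)
  rw [Finsupp.add_apply, braid_apply_low q a d s h1 h] at h4
  exact eq_neg_of_add_eq_zero_left h4

/-- A leading index of a relation is the index of a root vector candidate. -/
lemma IsLeading.candidate {m k : ℕ} (h : IsLeading (relTens q a d s m) m k) :
    k ≤ m ∧ (m - k < k ∨ (m - k = k ∧ q ^ (k ^ 2) * (a * d) ^ k * s = -1)) := by
  obtain ⟨t, ht, h1, h0⟩ := h
  have hk : k ≤ m := by
    by_contra hk
    rw [mem_homTens.mp (mem_relTens.mp ht).1 _ _ (by omega)] at h1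
    exact zero_ne_one h1
  refine ⟨hk, ?_⟩
  rcases lt_trichotomy (m - k) k with h | h | h
  · exact Or.inl h
  · refine Or.inr ⟨h, ?_⟩
    obtain rfl : m = k + k := by omega
    rw [h] at h1
    have h2 := relTens_apply_bot ht h0
    rw [h1, mul_one, eq_neg_iff_add_eq_zero] at h2
    rw [eq_neg_iff_add_eq_zero, ← h2]
    ring
  · rw [relTens_apply_eq_zero ht h0 _ _ h] at h1
    exact absurd h1 zero_ne_one

end Leading

/-! ### Counting root vectors -/

section Counting

variable {𝕜 : Type*} [Field 𝕜] {Q : Fin 2 → Fin 2 → 𝕜ˣ}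

/-- A root vector candidate of degree `m α_1 + 2 α_2` is a linear combination of larger monomials
if and only if it is the leading term of a relation. -/
lemma mem_span_largerMonomials_iff [CharZero 𝕜] {a b m : ℕ} (hab : b ≤ a) (hm : a + b = m)
    (hy : ∀ k, k < m → lowerCoeff (Q 0 0 : 𝕜) (Q 0 1 * Q 1 0) (k + 1) ≠ 0) :
    mulTens Q (candTens Q a b) ∈
      Submodule.span 𝕜 (Candidate.largerMonomials Q (wordTwo a b)) ↔
      IsLeading (relTens (Q 0 0 : 𝕜) (Q 0 1) (Q 1 0) (Q 1 1) m) m a := by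
  have hb : m - a = b := by omega
  constructor
  · intro h
    have hgr : mulTens Q (candTens Q a b) ∈ graded Q ![m, 2] := by
      refine map_supported_mem (mulTens Q) (fun i j hij => ?_) (candTens_mem Q hab)
      have hij' : i + j = a + b := hij
      have h1 := superLetter_mem_graded (Q := Q) (wordOne i)
      have h2 := superLetter_mem_graded (Q := Q) (wordOne j)
      have h3 := mul_mem_graded h1 h2
      rw [← degree_append] at h3
      have e : degree (wordOne i ++ wordOne j) = ![m, 2] := by
        rw [degree_append, degree_wordOne, degree_wordOne]
        ext x
        fin_cases x
        · simp; omega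
        · simp
      rw [e] at h3
      rw [mulTens_tens]
      exact h3
    have h1 := mem_span_inter_graded (fun y hy => by
      obtain ⟨l, -, -, rfl⟩ := hy
      exact ⟨_, prod_mem_graded l⟩) hgr h
    obtain ⟨t, ht, htx⟩ := Submodule.span_le.mpr (largerMonomials_subset hab hm) h1
    have htm : t ∈ homTens 𝕜 m := Finsupp.supported_mono (fun p hp => hp.1) ht
    have hta : ∀ i j, ¬ (i < a ∧ j < a) → t (i, j) = 0 := fun i j hij =>
      (Finsupp.mem_supported' 𝕜 t).mp ht (i, j) fun hp => hij hp.2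
    have hmem : candTens Q a b - t ∈ homTens 𝕜 m :=
      Submodule.sub_mem _ (hm ▸ candTens_mem Q hab) htm
    refine ⟨candTens Q a b - t, ?_, ?_, ?_⟩
    · rw [← mulTens_eq_zero_iff hy hmem, map_sub, htx, sub_self]
    · rw [hb, Finsupp.sub_apply, candTens_apply_top Q hab, hta a b (by omega), sub_zero]
    · intro i j hi
      rw [Finsupp.sub_apply, candTens_apply_eq_zero Q hab (Or.inl hi), hta i j (by omega),
        sub_zero]
  · rintro ⟨t, ht, h1, h0⟩
    rw [hb] at h1
    have htm := (mem_relTens.mp ht).1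
    have hμ : mulTens Q t = 0 := (mulTens_eq_zero_iff hy htm).mpr ht
    have h2 : mulTens Q (candTens Q a b) = mulTens Q (candTens Q a b - t) := by
      rw [map_sub, hμ, sub_zero]
    rw [h2]
    -- Candidate and relation agree at (a, b) and (b, a) and vanish outside, so only pairs with both
    -- indices below a survive in the difference.
    refine map_supported_mem (mulTens Q) (A := lowerPairs a m) (fun i j hij => ?_) ?_
    · obtain ⟨h3, h4, h5⟩ : i + j = m ∧ i < a ∧ j < a := hij
      rw [mulTens_tens]
      exact adGen_mul_adGen_mem_span i j h4 h5 (h3.trans hm.symm)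
    · rw [Finsupp.mem_supported']
      rintro ⟨i, j⟩ hij
      rw [Finsupp.sub_apply]
      by_cases hs : i + j = m
      swap
      · rw [mem_homTens.mp htm i j hs, mem_homTens.mp (hm ▸ candTens_mem Q hab) i j hs, sub_zero]
      rcases lt_trichotomy a i with hi | rfl | hi
      · rw [h0 i j hi, candTens_apply_eq_zero Q hab (Or.inl hi), sub_zero]
      · obtain rfl : j = b := by omega
        rw [h1, candTens_apply_top Q hab, sub_self]
      · rcases lt_trichotomy a j with hj | rfl | hj
        · rw [relTens_apply_eq_zero ht h0 i j hj, candTens_apply_eq_zero Q hab (Or.inr hj),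
            sub_zero]
        · obtain rfl : i = b := by omega
          subst hm
          rw [relTens_apply_bot ht h0, h1, candTens_apply_bot Q hi, mul_one, sub_self]
        · exact absurd ⟨hs, hi, hj⟩ hij

variable (Q) in
/-- The index `a` belongs to a root vector candidate with word `0^a 1 0^{m-a} 1`. -/
def IsCandidateIndex (m a : ℕ) : Prop :=
  m - a < a ∨ (m - a = a ∧
    (Q 0 0 : 𝕜) ^ (a ^ 2) * (Q 0 1 * Q 1 0 : 𝕜) ^ a * Q 1 1 = -1)

lemma wordTwo_injective (m : ℕ) : Function.Injective fun a => wordTwo a (m - a) :=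
  fun _ _ h => (wordTwo_inj h).1

lemma degree_eq_iff {w : List (Fin 2)} {a b m : ℕ} (hw : w = wordTwo a b) :
    degree w = ![m, 2] ↔ a + b = m := by
  rw [hw, degree_wordTwo]
  constructor
  · intro h
    simpa using congrFun h 0
  · rintro rfl; rfl

open Classical in
lemma candidateWords_eq [CharZero 𝕜] (m : ℕ) : candidateWords Q ![m, 2] =
    (((Finset.range (m + 1)).filter (IsCandidateIndex Q m)).image
      fun a => wordTwo a (m - a) : Finset (List (Fin 2))) := by
  ext w
  simp only [Finset.coe_image, Finset.coe_filter, Finset.mem_range, Set.mem_image,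
    Set.mem_ofPred_eq, candidateWords]
  constructor
  · rintro ⟨hd, c, rfl⟩
    obtain ⟨a, b, hab, hw, -⟩ := c.eq_wordTwo (congrFun hd 1)
    have hs := (degree_eq_iff hw).mp hd
    obtain rfl : b = m - a := by omega
    exact ⟨a, ⟨by omega, hab⟩, hw.symm⟩
  · rintro ⟨a, ⟨ha, hc⟩, rfl⟩
    refine ⟨(degree_eq_iff rfl).mpr (by omega), ?_⟩
    rcases hc with hc | ⟨hc, hχ⟩
    · exact ⟨Candidate.two Q hc, Candidate.word_two hc⟩
    · rw [hc]
      exact ⟨Candidate.square a hχ, Candidate.word_square a hχ⟩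

open Classical in
lemma rootWords_eq [CharZero 𝕜] {m : ℕ}
    (hy : ∀ k, k < m → lowerCoeff (Q 0 0 : 𝕜) (Q 0 1 * Q 1 0) (k + 1) ≠ 0) :
    rootWords Q ![m, 2] = ((((Finset.range (m + 1)).filter (IsCandidateIndex Q m)) \
      ((Finset.range (m + 1)).filter
        (IsLeading (relTens (Q 0 0 : 𝕜) (Q 0 1) (Q 1 0) (Q 1 1) m) m))).image
      fun a => wordTwo a (m - a) : Finset (List (Fin 2))) := by
  have root_iff : ∀ (c : Candidate Q) (a : ℕ), a ≤ m → m - a ≤ a →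
      c.word = wordTwo a (m - a) → (c.IsRootVector ↔
        ¬ IsLeading (relTens (Q 0 0 : 𝕜) (Q 0 1) (Q 1 0) (Q 1 1) m) m a) := by
    intro c a ham ha hw
    obtain ⟨a', b', -, hw', hv⟩ := c.eq_wordTwo
      (by rw [hw]; exact congrFun (degree_wordTwo a (m - a)) 1)
    rw [hw] at hw'
    obtain ⟨rfl, rfl⟩ := wordTwo_inj hw'
    rw [Candidate.IsRootVector, hv, hw, mem_span_largerMonomials_iff ha (by omega) hy]
  ext w
  simp only [Finset.coe_image, Finset.coe_sdiff, Finset.coe_filter, Finset.mem_range,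
    Set.mem_image, Set.mem_sdiff, Set.mem_ofPred_eq, rootWords]
  constructor
  · rintro ⟨hd, c, rfl, hroot⟩
    obtain ⟨a, b, hab, hw, -⟩ := c.eq_wordTwo (congrFun hd 1)
    have hs := (degree_eq_iff hw).mp hd
    obtain rfl : b = m - a := by omega
    refine ⟨a, ⟨⟨by omega, hab⟩, fun h => ?_⟩, hw.symm⟩
    exact (root_iff c a (by omega) (by omega) hw).mp hroot h.2
  · rintro ⟨a, ⟨⟨ha, hc⟩, hl⟩, rfl⟩
    refine ⟨(degree_eq_iff rfl).mpr (by omega), ?_⟩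
    have hl' : ¬ IsLeading (relTens (Q 0 0 : 𝕜) (Q 0 1) (Q 1 0) (Q 1 1) m) m a :=
      fun h => hl ⟨ha, h⟩
    have hex : ∃ c : Candidate Q, c.word = wordTwo a (m - a) := by
      rcases hc with hc | ⟨hc, hχ⟩
      · exact ⟨Candidate.two Q hc, Candidate.word_two hc⟩
      · rw [hc]
        exact ⟨Candidate.square a hχ, Candidate.word_square a hχ⟩
    obtain ⟨c, hcw⟩ := hex
    have hle : m - a ≤ a := by
      rcases hc with hc | ⟨hc, -⟩ <;> omega
    exact ⟨c, hcw, (root_iff c a (by omega) hle hcw).mpr hl'⟩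

open Classical in
lemma card_candidateIndex (m : ℕ) :
    ((Finset.range (m + 1)).filter (IsCandidateIndex Q m)).card =
      mPrime (Q 0 0 : 𝕜) (Q 0 1 * Q 1 0) (Q 1 1) m := by
  rw [mPrime]
  split_ifs with hodd hχ
  · have : (Finset.range (m + 1)).filter (IsCandidateIndex Q m) =
        Finset.Ico ((m + 1) / 2) (m + 1) := by
      obtain ⟨k, rfl⟩ := hodd
      ext a
      simp only [Finset.mem_filter, Finset.mem_range, Finset.mem_Ico, IsCandidateIndex]
      constructor
      · rintro ⟨h1, h2 | ⟨h2, -⟩⟩ <;> omega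
      · rintro ⟨h1, h2⟩
        exact ⟨h2, Or.inl (by omega)⟩
    rw [this, Nat.card_Ico]
    obtain ⟨k, rfl⟩ := hodd
    omega
  all_goals
    obtain ⟨k, rfl⟩ := Nat.not_odd_iff_even.mp hodd
    have e1 : (k + k) ^ 2 / 4 = k ^ 2 := by
      have : (k + k) ^ 2 = k ^ 2 * 4 := by ring
      rw [this, Nat.mul_div_cancel _ (by norm_num)]
    have e2 : (k + k) / 2 = k := by omega
    rw [e1, e2] at hχ
    rw [e2]
  · have : (Finset.range (k + k + 1)).filter (IsCandidateIndex Q (k + k)) =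
        Finset.Ico k (k + k + 1) := by
      ext a
      simp only [Finset.mem_filter, Finset.mem_range, Finset.mem_Ico, IsCandidateIndex]
      constructor
      · rintro ⟨h1, h2 | ⟨h2, -⟩⟩ <;> omega
      · rintro ⟨h1, h2⟩
        rcases h1.eq_or_lt with rfl | h1
        · exact ⟨h2, Or.inr ⟨by omega, hχ⟩⟩
        · exact ⟨h2, Or.inl (by omega)⟩
    rw [this, Nat.card_Ico]
    omega
  · have : (Finset.range (k + k + 1)).filter (IsCandidateIndex Q (k + k)) =
        Finset.Ico (k + 1) (k + k + 1) := by
      ext a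
      simp only [Finset.mem_filter, Finset.mem_range, Finset.mem_Ico, IsCandidateIndex]
      constructor
      · rintro ⟨h1, h2 | ⟨h2, h3⟩⟩
        · omega
        · obtain rfl : a = k := by omega
          exact absurd h3 hχ
      · rintro ⟨h1, h2⟩
        exact ⟨h2, Or.inl (by omega)⟩
    rw [this, Nat.card_Ico]
    omega

lemma lowerCoeff_ne_zero {q r : 𝕜} {m : ℕ} (hm : qFactorial q m * bCoeff q r m ≠ 0) :
    ∀ k, k < m → lowerCoeff q r (k + 1) ≠ 0 := by
  intro k hk
  obtain ⟨h1, h2⟩ := mul_ne_zero_iff.mp hm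
  rw [qFactorial, Finset.prod_ne_zero_iff] at h1
  rw [bCoeff, Finset.prod_ne_zero_iff] at h2
  rw [lowerCoeff_succ]
  exact mul_ne_zero (h1 (k + 1) (Finset.mem_Icc.mpr ⟨by omega, by omega⟩))
    (h2 k (Finset.mem_range.mpr hk))

end Counting

end

end DiagNichols

theorem corollary4p19 {𝕜 : Type*} [Field 𝕜] [CharZero 𝕜] (Q : Fin 2 → Fin 2 → 𝕜ˣ)
    (q r s : 𝕜) (hq : q = Q 0 0) (hr : r = Q 0 1 * Q 1 0) (hs : s = Q 1 1)
    (m : ℕ) (hm : DiagNichols.qFactorial q m * DiagNichols.bCoeff q r m ≠ 0) :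
    (DiagNichols.candidateWords Q ![m, 2]).ncard = DiagNichols.mPrime q r s m ∧
    (DiagNichols.multiplicity Q ![m, 2] : ℤ) =
      (DiagNichols.mPrime q r s m : ℤ) -
        ((DiagNichols.setJ q r s ∩ Set.Icc 0 m).ncard : ℤ) := by
  classical
  subst hq hr hs
  have hy := DiagNichols.lowerCoeff_ne_zero hm
  have hJ : DiagNichols.setJ (Q 0 0 : 𝕜) (Q 0 1 * Q 1 0) (Q 1 1) ∩ Set.Icc 0 m =
      DiagNichols.finJ (Q 0 0 : 𝕜) (Q 0 1 * Q 1 0) (Q 1 1) m := by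
    ext n
    rw [Finset.mem_coe, DiagNichols.mem_finJ]
    simp [DiagNichols.setJ, and_comm]
  have hrank := DiagNichols.finrank_relTens (s := (Q 1 1 : 𝕜)) (Units.ne_zero (Q 0 1)) hy
  rw [DiagNichols.finrank_eq_card_isLeading (DiagNichols.relTens_le_homTens m)] at hrank
  constructor
  · rw [DiagNichols.candidateWords_eq, Set.ncard_coe_finset,
      Finset.card_image_of_injective _ (DiagNichols.wordTwo_injective m),
      DiagNichols.card_candidateIndex]
  · rw [hJ, Set.ncard_coe_finset, ← hrank, DiagNichols.multiplicity, DiagNichols.rootWords_eq hy,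
      Set.ncard_coe_finset, Finset.card_image_of_injective _ (DiagNichols.wordTwo_injective m),
      ← DiagNichols.card_candidateIndex, Finset.cast_card_sdiff]
    -- Every leading index of a relation is a candidate index, so the cardinalities may be
    -- subtracted.
    intro a ha
    rw [Finset.mem_filter] at ha ⊢
    exact ⟨ha.1, ha.2.candidate.2⟩
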